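/- Let $D\subset\mathbb R^3$ be a nonempty bounded set and $B\subset\mathbb R^3$ a nonempty open set with $\overline B\cap\overline D=\emptyset$, and put $\operatorname{dist}(D,B)=\inf_{x\in D,\,y\in B}|x-y|$. Let $f\in L^2(\mathbb R^3)$ be real-valued with $\operatorname{supp} f\subset\overline B$, and suppose there is a constant $c_1>0$ such that either $f\ge c_1$ a.e. on $B$ or $-f\ge c_1$ a.e. on $B$. For $x,n\in\mathbb R^3$ with $|n|=1$, $h>0$ and $0<\theta<\pi$ let $C(x,n,h,\theta)=\{y\in\mathbb R^3 : |y-x|\le h,\ (y-x)\cdot n\ge|y-x|\cos\theta\}$. A set $S\subset\mathbb R^3$ satisfies condition (C) if for every $x\in\partial S$ there is a cone $C(x,n,h,\theta)$ with $C(x,n,h,\theta)\setminus\{x\}\subset S$. The set $D$ has $C^1$ boundary if every $x\in\partial D$ has an open neighbourhood $U$ and a $C^1$ function $\varphi:U\to\mathbb R$ with $\nabla\varphi(x)\ne0$ and $\{\varphi<0\}\subset D\cap U\subset\{\varphi\le0\}$. Suppose that either (a) $D$ has $C^1$ boundary and $B$ satisfies condition (C), or (b) $D$ and $B$ satisfy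 condition (C) and $B$ is convex. Then there is a constant $C>0$ (independent of $\tau$) such that for every $\tau\ge1$ the equation $$(\Delta-\tau^2)v+f=0\quad\text{in }\mathbb R^3$$ has a weak solution $v=v(\cdot;\tau)\in H^1(\mathbb R^3)$, and every such solution satisfies $$C^{-1}\tau^{-7}e^{-2\tau\operatorname{dist}(D,B)}\le\|\nabla v(\cdot;\tau)\|_{L^2(D)}^2\le C\tau^2e^{-2\tau\operatorname{dist}(D,B)}.$$ -/

import Mathlib

open MeasureTheory
open scoped ContDiff

noncomputable section

/-- Euclidean three-space. -/
abbrev E3 : Type := EuclideanSpace ℝ (Fin 3)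

/-- `dist(D, B) = inf {|x - y| : x ∈ D, y ∈ B}`. -/
def setDist (D B : Set E3) : ℝ :=
  sInf {r : ℝ | ∃ x ∈ D, ∃ y ∈ B, r = ‖x - y‖}

/-- The closed truncated cone with vertex `x`, direction `n`, radius `h` and opening angle `θ`. -/
def closedCone (x n : E3) (h θ : ℝ) : Set E3 :=
  {y : E3 | ‖y - x‖ ≤ h ∧ ‖y - x‖ * Real.cos θ ≤ inner ℝ (y - x) n}

/-- Condition (C): every boundary point of `S` is the vertex of a nondegenerate cone which,
apart from its vertex, lies in `S`. -/
def ConeCondition (S : Set E3) : Prop :=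
  ∀ x ∈ frontier S, ∃ (n : E3) (h θ : ℝ), ‖n‖ = 1 ∧ 0 < h ∧ 0 < θ ∧ θ < Real.pi ∧
    closedCone x n h θ \ {x} ⊆ S

/-- `S` has `C^1` boundary: near each boundary point there is a `C^1` function `φ` with nonzero
differential at that point such that `S` lies between `{φ < 0}` and `{φ ≤ 0}`. For open `S` this
says that `S` is locally `{φ < 0}`; the two inclusions leave it open which boundary points belong
to `S`. -/
def HasC1Boundary (S : Set E3) : Prop :=
  ∀ x ∈ frontier S, ∃ (U : Set E3) (φ : E3 → ℝ), IsOpen U ∧ x ∈ U ∧ ContDiffOn ℝ 1 φ U ∧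
    fderiv ℝ φ x ≠ 0 ∧ (∀ y ∈ U, φ y < 0 → y ∈ S) ∧ (∀ y ∈ U, y ∈ S → φ y ≤ 0)

/-- The emission condition on `B`: `f ∈ L²`, `supp f ⊆ closure B`, and `f` or `-f` is bounded
below on `B` by a positive constant. -/
def EmissionCondition (B : Set E3) (f : E3 → ℝ) : Prop :=
  MemLp f 2 volume ∧ (∀ᵐ x : E3, x ∉ closure B → f x = 0) ∧
    ∃ c : ℝ, 0 < c ∧ ((∀ᵐ x : E3, x ∈ B → c ≤ f x) ∨ (∀ᵐ x : E3, x ∈ B → c ≤ -f x))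

/-- `G` is the weak (distributional) gradient of `v` on `ℝ³`. -/
def IsWeakGradient (v : E3 → ℝ) (G : E3 → E3) : Prop :=
  ∀ φ : E3 → ℝ, ContDiff ℝ ∞ φ → HasCompactSupport φ → ∀ e : E3,
    ∫ x, v x * fderiv ℝ φ x e = -∫ x, inner ℝ (G x) e * φ x

/-- `v` is an `H¹(ℝ³)` function with weak gradient `G`, and it solves
`(Δ - τ²) v + f = 0` in `ℝ³` in the weak sense. -/
structure IsWeakSolution (τ : ℝ) (f v : E3 → ℝ) (G : E3 → E3) : Prop where
  memLp : MemLp v 2 volume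
  memLp_grad : MemLp G 2 volume
  weakGradient : IsWeakGradient v G
  equation : ∀ φ : E3 → ℝ, ContDiff ℝ ∞ φ → HasCompactSupport φ →
    (∫ x, inner ℝ (G x) (gradient φ x)) + τ ^ 2 * (∫ x, v x * φ x) = ∫ x, f x * φ x

end

open Filter Topology

/-- The `i`-th standard unit vector. -/
noncomputable abbrev unitVec (i : Fin 3) : E3 := EuclideanSpace.single i (1 : ℝ)

/-- The derivative of `φ` in direction `e`. -/
noncomputable def pd (e : E3) (φ : E3 → ℝ) : E3 → ℝ := fun x => fderiv ℝ φ x e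

/-- The Laplacian as the sum of the pure second derivatives. -/
noncomputable def lap (φ : E3 → ℝ) : E3 → ℝ := fun x => ∑ i, pd (unitVec i) (pd (unitVec i) φ) x

theorem ContDiff.pd {φ : E3 → ℝ} (h : ContDiff ℝ ∞ φ) (e : E3) : ContDiff ℝ ∞ (pd e φ) :=
  (h.fderiv_right (m := ∞) (by simp)).clm_apply contDiff_const

theorem ContDiff.lap {φ : E3 → ℝ} (h : ContDiff ℝ ∞ φ) : ContDiff ℝ ∞ (lap φ) :=
  ContDiff.sum fun i _ => (h.pd (unitVec i)).pd (unitVec i)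

theorem HasCompactSupport.pd {φ : E3 → ℝ} (h : HasCompactSupport φ) (e : E3) :
    HasCompactSupport (pd e φ) :=
  h.fderiv_apply (𝕜 := ℝ) e

theorem HasCompactSupport.lap {φ : E3 → ℝ} (h : HasCompactSupport φ) :
    HasCompactSupport (lap φ) := by
  have h3 : _root_.lap φ = _root_.pd (unitVec 0) (_root_.pd (unitVec 0) φ)
      + _root_.pd (unitVec 1) (_root_.pd (unitVec 1) φ)
      + _root_.pd (unitVec 2) (_root_.pd (unitVec 2) φ) := by
    ext x
    simp [_root_.lap, Fin.sum_univ_three]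
  rw [h3]
  exact (((h.pd _).pd _).add ((h.pd _).pd _)).add ((h.pd _).pd _)

theorem ContDiff.differentiable_infty {φ : E3 → ℝ} (h : ContDiff ℝ ∞ φ) : Differentiable ℝ φ :=
  h.differentiable (by simp)

theorem pd_mul {φ ψ : E3 → ℝ} (hφ : ContDiff ℝ ∞ φ) (hψ : ContDiff ℝ ∞ ψ) (e : E3) :
    pd e (fun x => φ x * ψ x) = fun x => φ x * pd e ψ x + pd e φ x * ψ x := by
  ext x
  simp only [pd]
  rw [fderiv_fun_mul (hφ.differentiable_infty x) (hψ.differentiable_infty x)]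
  simp [mul_comm]

theorem pd_add {φ ψ : E3 → ℝ} (hφ : ContDiff ℝ ∞ φ) (hψ : ContDiff ℝ ∞ ψ) (e : E3) :
    pd e (fun x => φ x + ψ x) = fun x => pd e φ x + pd e ψ x := by
  ext x
  simp only [pd]
  rw [fderiv_fun_add (hφ.differentiable_infty x) (hψ.differentiable_infty x)]
  simp

theorem pd_comm {φ : E3 → ℝ} (hφ : ContDiff ℝ ∞ φ) (e e' : E3) :
    pd e (pd e' φ) = pd e' (pd e φ) := by
  ext x
  have hd : DifferentiableAt ℝ (fderiv ℝ φ) x :=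
    (hφ.fderiv_right (m := ∞) (by simp)).differentiable (by simp) x
  have key : ∀ a c : E3, pd a (pd c φ) x = fderiv ℝ (fderiv ℝ φ) x a c := by
    intro a c
    unfold pd
    rw [fderiv_clm_apply hd (differentiableAt_const c)]
    simp
  rw [key, key]
  exact ((contDiff_infty.1 hφ 2).contDiffAt.isSymmSndFDerivAt (by simp)) e e'

theorem lap_pd {φ : E3 → ℝ} (hφ : ContDiff ℝ ∞ φ) (e : E3) : lap (pd e φ) = pd e (lap φ) := by
  ext x
  have h1 : pd e (lap φ) x = ∑ i, pd e (pd (unitVec i) (pd (unitVec i) φ)) x := by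
    have h2 : fderiv ℝ (lap φ) x = _ := fderiv_fun_sum (u := Finset.univ) fun i _ =>
      ((hφ.pd (unitVec i)).pd (unitVec i)).differentiable_infty x
    simp [pd, h2]
  rw [h1]
  unfold lap
  refine Finset.sum_congr rfl fun i _ => ?_
  rw [pd_comm hφ (unitVec i) e, pd_comm (hφ.pd _) e]

theorem lap_mul {χ φ : E3 → ℝ} (hχ : ContDiff ℝ ∞ χ) (hφ : ContDiff ℝ ∞ φ) :
    lap (fun x => χ x * φ x) = fun x => χ x * lap φ x
      + 2 * ∑ i, pd (unitVec i) χ x * pd (unitVec i) φ x + lap χ x * φ x := by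
  ext x
  have key : ∀ i : Fin 3, pd (unitVec i) (pd (unitVec i) (fun x => χ x * φ x)) x
      = χ x * pd (unitVec i) (pd (unitVec i) φ) x
        + 2 * (pd (unitVec i) χ x * pd (unitVec i) φ x)
        + pd (unitVec i) (pd (unitVec i) χ) x * φ x := by
    intro i
    rw [pd_mul hχ hφ, pd_add (hχ.mul (hφ.pd _)) ((hχ.pd _).mul hφ), pd_mul hχ (hφ.pd _),
      pd_mul (hχ.pd _) hφ]
    ring
  simp only [lap, key, Finset.sum_add_distrib, Finset.mul_sum, Finset.sum_mul]

theorem pd_comp_smul_sub {F : E3 → ℝ} (hF : ContDiff ℝ ∞ F) (e a : E3) (c : ℝ) :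
    pd e (fun x => F (c • (x - a))) = fun x => c * pd e F (c • (x - a)) := by
  ext x
  have h1 : HasFDerivAt (fun x : E3 => c • (x - a)) (c • ContinuousLinearMap.id ℝ E3) x :=
    ((hasFDerivAt_id x).sub_const a).const_smul c
  have h2 := ((hF.differentiable_infty (c • (x - a))).hasFDerivAt.comp x h1).fderiv
  unfold pd
  have h3 : (F ∘ fun x : E3 => c • (x - a)) = fun x => F (c • (x - a)) := rfl
  rw [← h3, h2]
  simp

theorem pd_const_mul {F : E3 → ℝ} (hF : ContDiff ℝ ∞ F) (e : E3) (c : ℝ) :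
    pd e (fun x => c * F x) = fun x => c * pd e F x := by
  ext x
  simp only [pd]
  rw [fderiv_const_mul (hF.differentiable_infty x)]
  simp

theorem contDiff_comp_smul_sub {F : E3 → ℝ} (hF : ContDiff ℝ ∞ F) (a : E3) (c : ℝ) :
    ContDiff ℝ ∞ (fun x => F (c • (x - a))) :=
  hF.comp (by fun_prop)

theorem lap_comp_smul_sub {F : E3 → ℝ} (hF : ContDiff ℝ ∞ F) (a : E3) (c : ℝ) :
    lap (fun x => F (c • (x - a))) = fun x => c ^ 2 * lap F (c • (x - a)) := by
  ext x
  simp only [lap, Finset.mul_sum]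
  refine Finset.sum_congr rfl fun i _ => ?_
  rw [pd_comp_smul_sub hF, pd_const_mul (contDiff_comp_smul_sub (hF.pd _) a c),
    pd_comp_smul_sub (hF.pd _)]
  ring

theorem inner_gradient_eq_pd (φ : E3 → ℝ) (x e : E3) : inner ℝ e (gradient φ x) = pd e φ x := by
  rw [real_inner_comm]
  simp [gradient, pd]

theorem pd_eq_sum (φ : E3 → ℝ) (e x : E3) : pd e φ x = ∑ i, e i * pd (unitVec i) φ x := by
  have h : e = ∑ i, e i • unitVec i := by
    ext j
    simp [Finset.sum_apply, Pi.single_apply]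
  conv_lhs => rw [h]
  simp [pd]

theorem inner_unitVec (e : E3) (i : Fin 3) : inner ℝ e (unitVec i) = e i := by
  simp [EuclideanSpace.inner_single_right]

theorem MeasureTheory.MemLp.inner_const_real {G : E3 → E3} (hG : MemLp G 2 volume) (e : E3) :
    MemLp (fun x => inner ℝ (G x) e) 2 volume :=
  hG.inner_const e

theorem memLp_two_of_test {φ : E3 → ℝ} (hφ : ContDiff ℝ ∞ φ) (hc : HasCompactSupport φ) :
    MemLp φ 2 (volume : Measure E3) :=
  hφ.continuous.memLp_of_hasCompactSupport hc

theorem integrable_mul_of_memLp_two {f g : E3 → ℝ} (hf : MemLp f 2 volume) (hg : MemLp g 2 volume) :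
    Integrable (fun x => f x * g x) volume :=
  hf.integrable_mul hg

theorem IsWeakSolution.integral_inner_gradient {τ : ℝ} {f v : E3 → ℝ} {G : E3 → E3}
    (h : IsWeakSolution τ f v G) {φ : E3 → ℝ} (hφ : ContDiff ℝ ∞ φ) (hc : HasCompactSupport φ) :
    ∫ x, inner ℝ (G x) (gradient φ x) = -∫ x, v x * lap φ x := by
  have h1 : ∀ i : Fin 3, ∫ x, G x i * pd (unitVec i) φ x
      = -∫ x, v x * pd (unitVec i) (pd (unitVec i) φ) x := by
    intro i
    have := h.weakGradient (pd (unitVec i) φ) (hφ.pd _) (hc.pd _) (unitVec i)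
    simp only [inner_unitVec] at this
    rw [eq_neg_iff_add_eq_zero, ← neg_eq_iff_add_eq_zero, ← this]
    rfl
  have h2 : ∀ x, inner ℝ (G x) (gradient φ x) = ∑ i, G x i * pd (unitVec i) φ x := by
    intro x
    rw [inner_gradient_eq_pd, pd_eq_sum]
  simp only [h2, lap, Finset.mul_sum]
  rw [integral_finsetSum, integral_finsetSum]
  · simp [h1]
  · intro i _
    exact integrable_mul_of_memLp_two h.memLp
      (memLp_two_of_test ((hφ.pd _).pd _) ((hc.pd _).pd _))
  · intro i _
    have := h.memLp_grad.inner_const_real (unitVec i)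
    simp only [inner_unitVec] at this
    exact integrable_mul_of_memLp_two this (memLp_two_of_test (hφ.pd _) (hc.pd _))

theorem IsWeakSolution.integral_mul_helmholtz {τ : ℝ} {f v : E3 → ℝ} {G : E3 → E3}
    (h : IsWeakSolution τ f v G) {φ : E3 → ℝ} (hφ : ContDiff ℝ ∞ φ) (hc : HasCompactSupport φ) :
    ∫ x, v x * (τ ^ 2 * φ x - lap φ x) = ∫ x, f x * φ x := by
  rw [← h.equation φ hφ hc, h.integral_inner_gradient hφ hc]
  have h1 : ∀ x, v x * (τ ^ 2 * φ x - lap φ x) = τ ^ 2 * (v x * φ x) - v x * lap φ x := by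
    intro x; ring
  simp only [h1]
  rw [integral_sub, integral_const_mul]
  · ring
  · exact (integrable_mul_of_memLp_two h.memLp (memLp_two_of_test hφ hc)).const_mul _
  · exact integrable_mul_of_memLp_two h.memLp (memLp_two_of_test hφ.lap hc.lap)

theorem IsWeakSolution.integral_grad_mul_helmholtz {τ : ℝ} {f v : E3 → ℝ} {G : E3 → E3}
    (h : IsWeakSolution τ f v G) {φ : E3 → ℝ} (hφ : ContDiff ℝ ∞ φ) (hc : HasCompactSupport φ)
    (e : E3) :
    ∫ x, inner ℝ (G x) e * (τ ^ 2 * φ x - lap φ x) = -∫ x, f x * pd e φ x := by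
  rw [← h.integral_mul_helmholtz (hφ.pd e) (hc.pd e)]
  have hs : ContDiff ℝ ∞ (fun x => τ ^ 2 * φ x - lap φ x) := (contDiff_const.mul hφ).sub hφ.lap
  have hcs : HasCompactSupport (fun x => τ ^ 2 * φ x - lap φ x) := hc.mul_left.sub hc.lap
  have h1 := h.weakGradient _ hs hcs e
  rw [eq_neg_iff_add_eq_zero, ← neg_eq_iff_add_eq_zero, ← h1]
  refine integral_congr_ae (Eventually.of_forall fun x => ?_)
  have h2 : pd e (fun x => τ ^ 2 * φ x - lap φ x) x = τ ^ 2 * pd e φ x - pd e (lap φ) x := by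
    have hneg : (fun x => τ ^ 2 * φ x - lap φ x) = fun x => τ ^ 2 * φ x + (-1) * lap φ x := by
      ext x; ring
    rw [hneg, pd_add (contDiff_const.mul hφ) (contDiff_const.mul hφ.lap), pd_const_mul hφ,
      pd_const_mul hφ.lap]
    ring
  change v x * pd e (fun x => τ ^ 2 * φ x - lap φ x) x = _
  rw [h2, lap_pd hφ]

theorem tendsto_integral_mul_bounded {w k : E3 → ℝ} (hw : MemLp w 2 volume) (hk : MemLp k 2 volume)
    {m : ℕ → E3 → ℝ} {C c : ℝ} (hm : ∀ n, Continuous (m n)) (hC : ∀ n x, |m n x| ≤ C)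
    (hlim : ∀ x, Tendsto (fun n => m n x) atTop (𝓝 c)) :
    Tendsto (fun n => ∫ x, w x * (m n x * k x)) atTop (𝓝 (c * ∫ x, w x * k x)) := by
  have hinteg := integrable_mul_of_memLp_two hw hk
  rw [← integral_const_mul]
  refine tendsto_integral_of_dominated_convergence (fun x => C * |w x * k x|) ?_ ?_ ?_ ?_
  · intro n
    exact hw.1.mul ((hm n).aestronglyMeasurable.mul hk.1)
  · exact hinteg.abs.const_mul C
  · intro n
    refine Eventually.of_forall fun x => ?_
    rw [Real.norm_eq_abs, mul_left_comm, abs_mul]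
    exact mul_le_mul_of_nonneg_right (hC n x) (abs_nonneg _)
  · refine Eventually.of_forall fun x => ?_
    have := (hlim x).mul_const (w x * k x)
    refine this.congr fun n => ?_
    ring

theorem exists_bound_of_test {φ : E3 → ℝ} (hφ : ContDiff ℝ ∞ φ) (hc : HasCompactSupport φ) :
    ∃ C, ∀ x, |φ x| ≤ C :=
  hc.exists_bound_of_continuous hφ.continuous

theorem abs_div_natCast_succ_le {t C : ℝ} (h : |t| ≤ C) (n : ℕ) : |((n : ℝ) + 1)⁻¹ * t| ≤ C := by
  rw [abs_mul, abs_of_pos (by positivity)]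
  have h1 : ((n : ℝ) + 1)⁻¹ ≤ 1 := inv_le_one_of_one_le₀ (by linarith [n.cast_nonneg (α := ℝ)])
  nlinarith [abs_nonneg t]

theorem tendsto_inv_mul_bounded {t : ℕ → ℝ} {C : ℝ} (h : ∀ n, |t n| ≤ C) :
    Tendsto (fun n : ℕ => ((n : ℝ) + 1)⁻¹ * t n) atTop (𝓝 0) := by
  have h0 : Tendsto (fun n : ℕ => ((n : ℝ) + 1)⁻¹) atTop (𝓝 0) :=
    tendsto_inv_atTop_zero.comp
      (tendsto_atTop_add_const_right _ _ tendsto_natCast_atTop_atTop)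
  exact h0.zero_mul_isBoundedUnder_le (isBoundedUnder_of ⟨C, h⟩)

/-- If `w` solves a weak form of `(τ² - Δ) w = f₁ - ∂ₑ f₂` against compactly supported smooth
functions, then also against smooth functions which are square integrable together with their
gradient and Laplacian. -/
theorem integral_mul_helmholtz_of_memLp {τ : ℝ} {w f₁ f₂ : E3 → ℝ} {e : E3}
    (hw : MemLp w 2 volume) (hf₁ : MemLp f₁ 2 volume) (hf₂ : MemLp f₂ 2 volume)
    (htest : ∀ φ : E3 → ℝ, ContDiff ℝ ∞ φ → HasCompactSupport φ →
      ∫ x, w x * (τ ^ 2 * φ x - lap φ x) = (∫ x, f₁ x * φ x) + ∫ x, f₂ x * pd e φ x)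
    {φ : E3 → ℝ} (hφ : ContDiff ℝ ∞ φ) (h0 : MemLp φ 2 volume)
    (h1 : ∀ e, MemLp (pd e φ) 2 volume) (h2 : MemLp (lap φ) 2 volume) :
    ∫ x, w x * (τ ^ 2 * φ x - lap φ x) = (∫ x, f₁ x * φ x) + ∫ x, f₂ x * pd e φ x := by
  let b : ContDiffBump (0 : E3) := ⟨1, 2, one_pos, one_lt_two⟩
  set χ : E3 → ℝ := fun x => b x with hχdef
  have hχ : ContDiff ℝ ∞ χ := b.contDiff
  have hχc : HasCompactSupport χ := b.hasCompactSupport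
  set X : ℕ → E3 → ℝ := fun n x => χ (((n : ℝ) + 1)⁻¹ • (x - 0)) with hX
  have hXs : ∀ n, ContDiff ℝ ∞ (X n) := fun n => contDiff_comp_smul_sub hχ 0 _
  have hXc : ∀ n, HasCompactSupport (X n) := by
    intro n
    have := hχc.comp_smul (c := ((n : ℝ) + 1)⁻¹) (by positivity)
    simpa [hX] using this
  have hX1 : ∀ n x, |X n x| ≤ 1 := by
    intro n x
    rw [abs_of_nonneg b.nonneg]
    exact b.le_one
  have hXlim : ∀ x, Tendsto (fun n => X n x) atTop (𝓝 1) := by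
    intro x
    refine tendsto_const_nhds.congr' ?_
    obtain ⟨N, hN⟩ := exists_nat_ge ‖x‖
    filter_upwards [eventually_ge_atTop N] with n hn
    symm
    apply b.one_of_mem_closedBall
    have hn' : (N : ℝ) ≤ n := by exact_mod_cast hn
    have hpos : (0 : ℝ) < (n : ℝ) + 1 := by positivity
    simp only [sub_zero, mem_closedBall_zero_iff, norm_smul, norm_inv, Real.norm_eq_abs,
      abs_of_pos hpos]
    change ((n : ℝ) + 1)⁻¹ * ‖x‖ ≤ 1
    rw [inv_mul_le_iff₀ hpos]
    linarith
  have hpdX : ∀ a n x, pd a (X n) x = ((n : ℝ) + 1)⁻¹ * pd a χ (((n : ℝ) + 1)⁻¹ • (x - 0)) := by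
    intro a n x
    rw [hX, pd_comp_smul_sub hχ]
  have hlapX : ∀ n x, lap (X n) x = ((n : ℝ) + 1)⁻¹ *
      (((n : ℝ) + 1)⁻¹ * lap χ (((n : ℝ) + 1)⁻¹ • (x - 0))) := by
    intro n x
    rw [hX, lap_comp_smul_sub hχ]
    ring
  have hpd : ∀ a, ∃ C, ∀ n x, |pd a (X n) x| ≤ C := by
    intro a
    obtain ⟨C, hC⟩ := exists_bound_of_test (hχ.pd a) (hχc.pd a)
    exact ⟨C, fun n x => by rw [hpdX]; exact abs_div_natCast_succ_le (hC _) n⟩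
  have hpdlim : ∀ a x, Tendsto (fun n => pd a (X n) x) atTop (𝓝 0) := by
    intro a x
    obtain ⟨C, hC⟩ := exists_bound_of_test (hχ.pd a) (hχc.pd a)
    simp only [hpdX]
    exact tendsto_inv_mul_bounded fun n => hC _
  obtain ⟨C₂, hC₂⟩ := exists_bound_of_test hχ.lap hχc.lap
  have hlap : ∀ n x, |lap (X n) x| ≤ C₂ := by
    intro n x
    rw [hlapX]
    exact abs_div_natCast_succ_le (abs_div_natCast_succ_le (hC₂ _) n) n
  have hlaplim : ∀ x, Tendsto (fun n => lap (X n) x) atTop (𝓝 0) := by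
    intro x
    simp only [hlapX]
    exact tendsto_inv_mul_bounded fun n => abs_div_natCast_succ_le (hC₂ _) n
  have hbm : ∀ {m k : E3 → ℝ} {C : ℝ}, Continuous m → (∀ x, |m x| ≤ C) → MemLp k 2 volume →
      MemLp (fun x => m x * k x) 2 (volume : Measure E3) := by
    intro m k C hm hC hk
    refine hk.of_le_mul (c := C) (hm.aestronglyMeasurable.mul hk.1)
      (Eventually.of_forall fun x => ?_)
    rw [norm_mul]
    exact mul_le_mul_of_nonneg_right (hC x) (norm_nonneg _)
  choose Cp hCp using hpd
  have hL : Tendsto (fun n => ∫ x, w x * (τ ^ 2 * (X n x * φ x) - lap (fun x => X n x * φ x) x))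
      atTop (𝓝 (∫ x, w x * (τ ^ 2 * φ x - lap φ x))) := by
    have hψ : MemLp (fun x => τ ^ 2 * φ x - lap φ x) 2 volume := (h0.const_mul _).sub h2
    have t1 := tendsto_integral_mul_bounded hw hψ (fun n => (hXs n).continuous) hX1 hXlim
    have t2 := fun i : Fin 3 => tendsto_integral_mul_bounded hw (h1 (unitVec i))
      (fun n => ((hXs n).pd (unitVec i)).continuous) (hCp (unitVec i)) (hpdlim (unitVec i))
    have t3 := tendsto_integral_mul_bounded hw h0 (fun n => (hXs n).lap.continuous) hlap hlaplim
    have t4 := (t1.sub ((tendsto_finsetSum Finset.univ fun i _ => t2 i).const_mul 2)).sub t3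
    simp only [one_mul, zero_mul, Finset.sum_const_zero, mul_zero, sub_zero] at t4
    refine t4.congr fun n => ?_
    have i1 := integrable_mul_of_memLp_two hw (hbm (hXs n).continuous (hX1 n) hψ)
    have i2 : ∀ i ∈ Finset.univ, Integrable
        (fun x => w x * (pd (unitVec i) (X n) x * pd (unitVec i) φ x)) volume :=
      fun i _ => integrable_mul_of_memLp_two hw
        (hbm ((hXs n).pd (unitVec i)).continuous (hCp (unitVec i) n) (h1 (unitVec i)))
    have i3 := integrable_mul_of_memLp_two hw (hbm (hXs n).lap.continuous (hlap n) h0)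
    have i2' := (integrable_finsetSum _ i2).const_mul 2
    rw [← integral_finsetSum _ i2, ← integral_const_mul, ← integral_sub i1 i2']
    refine (integral_sub (i1.sub i2') i3).symm.trans ?_
    refine integral_congr_ae (Eventually.of_forall fun x => ?_)
    simp only [lap_mul (hXs n) hφ, ← Finset.mul_sum, Pi.sub_apply]
    ring
  have hR : Tendsto (fun n => (∫ x, f₁ x * (X n x * φ x))
      + ∫ x, f₂ x * pd e (fun x => X n x * φ x) x)
      atTop (𝓝 ((∫ x, f₁ x * φ x) + ∫ x, f₂ x * pd e φ x)) := by
    have t1 := tendsto_integral_mul_bounded hf₁ h0 (fun n => (hXs n).continuous) hX1 hXlim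
    have t2 := tendsto_integral_mul_bounded hf₂ (h1 e) (fun n => (hXs n).continuous) hX1 hXlim
    have t3 := tendsto_integral_mul_bounded hf₂ h0 (fun n => ((hXs n).pd e).continuous) (hCp e)
      (hpdlim e)
    have t4 := t1.add (t2.add t3)
    simp only [one_mul, zero_mul, add_zero] at t4
    refine t4.congr fun n => ?_
    have i2 := integrable_mul_of_memLp_two hf₂ (hbm (hXs n).continuous (hX1 n) (h1 e))
    have i3 := integrable_mul_of_memLp_two hf₂ (hbm ((hXs n).pd e).continuous (hCp e n) h0)
    rw [← integral_add i2 i3]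
    congr 1
    refine integral_congr_ae (Eventually.of_forall fun x => ?_)
    simp only [pd_mul (hXs n) hφ]
    ring
  refine tendsto_nhds_unique hL (hR.congr fun n => ?_)
  exact (htest _ ((hXs n).mul hφ) (hXc n).mul_right).symm

theorem IsWeakSolution.integral_mul_helmholtz_of_memLp {τ : ℝ} {f v : E3 → ℝ} {G : E3 → E3}
    (h : IsWeakSolution τ f v G) (hf : MemLp f 2 volume) {φ : E3 → ℝ} (hφ : ContDiff ℝ ∞ φ)
    (h0 : MemLp φ 2 volume) (h1 : ∀ e, MemLp (pd e φ) 2 volume) (h2 : MemLp (lap φ) 2 volume) :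
    ∫ x, v x * (τ ^ 2 * φ x - lap φ x) = ∫ x, f x * φ x := by
  have := _root_.integral_mul_helmholtz_of_memLp (e := 0) h.memLp hf
    (MemLp.zero (p := 2) (μ := volume) (ε := ℝ))
    (fun φ hφ hc => by simpa using h.integral_mul_helmholtz hφ hc) hφ h0 h1 h2
  simpa using this

theorem IsWeakSolution.integral_grad_mul_helmholtz_of_memLp {τ : ℝ} {f v : E3 → ℝ} {G : E3 → E3}
    (h : IsWeakSolution τ f v G) (hf : MemLp f 2 volume) {φ : E3 → ℝ} (hφ : ContDiff ℝ ∞ φ)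
    (h0 : MemLp φ 2 volume) (h1 : ∀ e, MemLp (pd e φ) 2 volume) (h2 : MemLp (lap φ) 2 volume)
    (e : E3) :
    ∫ x, inner ℝ (G x) e * (τ ^ 2 * φ x - lap φ x) = -∫ x, f x * pd e φ x := by
  have := _root_.integral_mul_helmholtz_of_memLp (e := e) (h.memLp_grad.inner_const_real e)
    (MemLp.zero (p := 2) (μ := volume) (ε := ℝ)) hf.neg
    (fun φ hφ hc => by simpa [integral_neg] using h.integral_grad_mul_helmholtz hφ hc e)
    hφ h0 h1 h2
  simpa [integral_neg] using this

/-- The Hilbert space of pairs of a square integrable function and a square integrable vector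
field. -/
abbrev L2Pair : Type :=
  WithLp 2 (Lp ℝ 2 (volume : Measure E3) × Lp E3 2 (volume : Measure E3))

/-- The element of `L2Pair` given by two square integrable functions. -/
noncomputable def l2Pair {g : E3 → ℝ} {k : E3 → E3} (hg : MemLp g 2 volume)
    (hk : MemLp k 2 volume) : L2Pair :=
  WithLp.toLp 2 (hg.toLp g, hk.toLp k)

theorem l2Pair_fst {g : E3 → ℝ} {k : E3 → E3} (hg : MemLp g 2 volume)
    (hk : MemLp k 2 volume) : ((l2Pair hg hk).fst : E3 → ℝ) =ᵐ[volume] g :=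
  hg.coeFn_toLp

theorem l2Pair_snd {g : E3 → ℝ} {k : E3 → E3} (hg : MemLp g 2 volume)
    (hk : MemLp k 2 volume) : ((l2Pair hg hk).snd : E3 → E3) =ᵐ[volume] k :=
  hk.coeFn_toLp

theorem inner_l2Pair {g : E3 → ℝ} {k : E3 → E3} (hg : MemLp g 2 volume)
    (hk : MemLp k 2 volume) (p : L2Pair) :
    inner ℝ (l2Pair hg hk) p = (∫ x, p.fst x * g x) + ∫ x, inner ℝ (p.snd x) (k x) := by
  rw [WithLp.prod_inner_apply, L2.inner_def, L2.inner_def]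
  congr 1
  · refine integral_congr_ae ?_
    filter_upwards [l2Pair_fst hg hk] with x hx
    simp [hx]
  · refine integral_congr_ae ?_
    filter_upwards [l2Pair_snd hg hk] with x hx
    change inner ℝ ((l2Pair hg hk).snd x) (p.snd x) = _
    rw [hx]
    exact real_inner_comm _ _

theorem memLp_test_smul {φ : E3 → ℝ} (hφ : ContDiff ℝ ∞ φ) (hc : HasCompactSupport φ) (e : E3) :
    MemLp (fun x => φ x • e) 2 (volume : Measure E3) :=
  (hφ.continuous.smul continuous_const).memLp_of_hasCompactSupport hc.smul_right

theorem memLp_gradient {φ : E3 → ℝ} (hφ : ContDiff ℝ ∞ φ) (hc : HasCompactSupport φ) :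
    MemLp (gradient φ) 2 (volume : Measure E3) := by
  refine Continuous.memLp_of_hasCompactSupport ?_ ?_
  · exact (LinearIsometryEquiv.continuous _).comp (hφ.continuous_fderiv (by simp))
  · exact (hc.fderiv (𝕜 := ℝ)).comp_left (map_zero _)

theorem integral_test_mul_pd {φ χ : E3 → ℝ} (hφ : ContDiff ℝ ∞ φ) (hφc : HasCompactSupport φ)
    (hχ : ContDiff ℝ ∞ χ) (hχc : HasCompactSupport χ) (e : E3) :
    ∫ x, φ x * pd e χ x = -∫ x, pd e φ x * χ x :=
  integral_mul_fderiv_eq_neg_fderiv_mul_of_integrable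
    (integrable_mul_of_memLp_two (memLp_two_of_test (hφ.pd e) (hφc.pd e)) (memLp_two_of_test hχ hχc))
    (integrable_mul_of_memLp_two (memLp_two_of_test hφ hφc) (memLp_two_of_test (hχ.pd e) (hχc.pd e)))
    (integrable_mul_of_memLp_two (memLp_two_of_test hφ hφc) (memLp_two_of_test hχ hχc))
    (fun x _ => hφ.differentiable_infty x) (fun x _ => hχ.differentiable_infty x)

theorem exists_isWeakSolution {τ : ℝ} (hτ : 0 < τ) {f : E3 → ℝ} (hf : MemLp f 2 volume) :
    ∃ (v : E3 → ℝ) (G : E3 → E3), IsWeakSolution τ f v G := by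
  let W : Submodule ℝ L2Pair := Submodule.span ℝ {p | ∃ (φ : E3 → ℝ) (hφ : ContDiff ℝ ∞ φ)
    (hc : HasCompactSupport φ) (e : E3),
    p = l2Pair ((memLp_two_of_test (hφ.pd e) (hc.pd e)).const_mul τ⁻¹) (memLp_test_smul hφ hc e)}
  have hX : MemLp (fun x => τ⁻¹ * f x) 2 volume := hf.const_mul _
  set X : L2Pair := l2Pair hX (MemLp.zero (p := 2) (μ := volume) (ε := E3)) with hXdef
  set P : L2Pair := Wᗮ.starProjection X with hP
  have hPmem : P ∈ Wᗮ := Submodule.starProjection_apply_mem _ _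
  have hPorth : ∀ s ∈ Wᗮ, inner ℝ s X = inner ℝ s P := by
    intro s hs
    have := (Submodule.sub_starProjection_mem_orthogonal (K := Wᗮ) X) s hs
    rw [inner_sub_right, sub_eq_zero] at this
    exact this
  have hv : MemLp (fun x => τ⁻¹ * P.fst x) 2 volume := (Lp.memLp P.fst).const_mul _
  refine ⟨fun x => τ⁻¹ * P.fst x, P.snd, hv, Lp.memLp P.snd, ?_, ?_⟩
  · intro φ hφ hc e
    have h1 := hPmem _ (Submodule.subset_span ⟨φ, hφ, hc, e, rfl⟩)
    rw [inner_l2Pair] at h1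
    rw [eq_neg_iff_add_eq_zero, ← h1]
    congr 1
    · refine integral_congr_ae (Eventually.of_forall fun x => ?_)
      simp only [pd]
      ring
    · refine integral_congr_ae (Eventually.of_forall fun x => ?_)
      simp only [inner_smul_right]
      ring
  · intro φ hφ hc
    have hs : l2Pair ((memLp_two_of_test hφ hc).const_mul τ) (memLp_gradient hφ hc) ∈ Wᗮ := by
      rw [Submodule.mem_orthogonal']
      intro u hu
      induction hu using Submodule.span_induction with
      | mem u hu =>
        obtain ⟨χ, hχ, hχc, e, rfl⟩ := hu
        rw [real_inner_comm, inner_l2Pair]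
        have e1 : ∫ x, (l2Pair ((memLp_two_of_test hφ hc).const_mul τ)
            (memLp_gradient hφ hc)).fst x * (τ⁻¹ * pd e χ x) = ∫ x, φ x * pd e χ x := by
          refine integral_congr_ae ?_
          filter_upwards [l2Pair_fst ((memLp_two_of_test hφ hc).const_mul τ)
            (memLp_gradient hφ hc)] with x hx
          rw [hx]
          field_simp
        have e2 : ∫ x, inner ℝ ((l2Pair ((memLp_two_of_test hφ hc).const_mul τ)
            (memLp_gradient hφ hc)).snd x) (χ x • e) = ∫ x, pd e φ x * χ x := by
          refine integral_congr_ae ?_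
          filter_upwards [l2Pair_snd ((memLp_two_of_test hφ hc).const_mul τ)
            (memLp_gradient hφ hc)] with x hx
          rw [hx, inner_smul_right, real_inner_comm, inner_gradient_eq_pd, mul_comm]
        rw [e1, e2, integral_test_mul_pd hφ hc hχ hχc]
        simp
      | zero => simp
      | add u w _ _ hu hw => rw [inner_add_right, hu, hw, add_zero]
      | smul c u _ hu => rw [inner_smul_right, hu, mul_zero]
    have h2 := hPorth _ hs
    rw [inner_l2Pair, inner_l2Pair] at h2
    have e1 : ∫ x, X.fst x * (τ * φ x) = ∫ x, f x * φ x := by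
      refine integral_congr_ae ?_
      filter_upwards [l2Pair_fst hX MemLp.zero] with x hx
      rw [hXdef, hx]
      field_simp
    have e2 : ∫ x, inner ℝ (X.snd x) (gradient φ x) = 0 := by
      refine integral_eq_zero_of_ae ?_
      filter_upwards [l2Pair_snd hX MemLp.zero] with x hx
      rw [hXdef, hx]
      simp
    rw [e1, e2, add_zero] at h2
    rw [h2, add_comm, ← integral_const_mul]
    congr 1
    refine integral_congr_ae (Eventually.of_forall fun x => ?_)
    simp only
    field_simp

theorem contDiff_radial {g : ℝ → ℝ} (hg : ContDiff ℝ ∞ g) :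
    ContDiff ℝ ∞ (fun x : E3 => g (‖x‖ ^ 2)) :=
  hg.comp (contDiff_norm_sq ℝ)

theorem pd_radial {g : ℝ → ℝ} (hg : ContDiff ℝ ∞ g) (e : E3) :
    pd e (fun x : E3 => g (‖x‖ ^ 2)) = fun x => 2 * deriv g (‖x‖ ^ 2) * inner ℝ x e := by
  ext x
  have h1 : HasFDerivAt (fun x : E3 => ‖x‖ ^ 2) (2 • innerSL ℝ x) x :=
    (hasStrictFDerivAt_norm_sq x).hasFDerivAt
  have h2 : HasDerivAt g (deriv g (‖x‖ ^ 2)) (‖x‖ ^ 2) :=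
    (hg.differentiable (by simp) _).hasDerivAt
  have h3 := (h2.comp_hasFDerivAt x h1).fderiv
  unfold pd
  change fderiv ℝ (g ∘ fun x : E3 => ‖x‖ ^ 2) x e = _
  rw [h3]
  simp
  ring

theorem contDiff_deriv_infty {g : ℝ → ℝ} (hg : ContDiff ℝ ∞ g) : ContDiff ℝ ∞ (deriv g) :=
  (contDiff_infty_iff_deriv.1 hg).2

theorem pd_pd_radial {g : ℝ → ℝ} (hg : ContDiff ℝ ∞ g) (e : E3) :
    pd e (pd e (fun x : E3 => g (‖x‖ ^ 2))) = fun x =>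
      4 * deriv (deriv g) (‖x‖ ^ 2) * inner ℝ x e ^ 2 + 2 * deriv g (‖x‖ ^ 2) * ‖e‖ ^ 2 := by
  have hg' : ContDiff ℝ ∞ (deriv g) := contDiff_deriv_infty hg
  have hr := contDiff_radial hg'
  have hl : ContDiff ℝ ∞ (fun x : E3 => inner ℝ x e) := contDiff_id.inner ℝ contDiff_const
  have hle : pd e (fun x : E3 => inner ℝ x e) = fun _ => ‖e‖ ^ 2 := by
    ext x
    have h1 : HasFDerivAt (fun x : E3 => inner ℝ x e) (innerSL ℝ e) x := by
      have : (fun x : E3 => inner ℝ x e) = innerSL ℝ e := by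
        ext y
        simp [real_inner_comm]
      rw [this]
      exact (innerSL ℝ e).hasFDerivAt
    unfold pd
    rw [h1.fderiv]
    simp
  rw [pd_radial hg, pd_mul (contDiff_const.mul hr) hl, pd_const_mul hr, pd_radial hg', hle]
  ext x
  ring

theorem lap_radial {g : ℝ → ℝ} (hg : ContDiff ℝ ∞ g) :
    lap (fun x : E3 => g (‖x‖ ^ 2)) = fun x =>
      4 * ‖x‖ ^ 2 * deriv (deriv g) (‖x‖ ^ 2) + 6 * deriv g (‖x‖ ^ 2) := by
  ext x
  have h : ‖x‖ ^ 2 = x 0 ^ 2 + x 1 ^ 2 + x 2 ^ 2 := by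
    rw [EuclideanSpace.norm_sq_eq, Fin.sum_univ_three]
    simp
  simp only [lap, pd_pd_radial hg, Fin.sum_univ_three, inner_unitVec]
  generalize deriv g (‖x‖ ^ 2) = A
  generalize deriv (deriv g) (‖x‖ ^ 2) = B
  rw [h]
  simp
  ring

/-- A smooth function which vanishes on `u ≤ 1/2` and equals one on `1 ≤ u`. -/
noncomputable def cut (u : ℝ) : ℝ := Real.smoothTransition (2 * u - 1)

theorem contDiff_cut : ContDiff ℝ ∞ cut :=
  Real.smoothTransition.contDiff.comp (by fun_prop)

theorem cut_of_le {u : ℝ} (h : u ≤ 1 / 2) : cut u = 0 :=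
  Real.smoothTransition.zero_of_nonpos (by linarith)

theorem cut_of_ge {u : ℝ} (h : 1 ≤ u) : cut u = 1 :=
  Real.smoothTransition.one_of_one_le (by linarith)

/-- The Yukawa potential `e^{-μr}/r` as a function of `u = r²`. -/
noncomputable def yukawa (μ u : ℝ) : ℝ := Real.exp (-(μ * √u)) / √u

/-- The derivative of `yukawa μ`. -/
noncomputable def yukawaDeriv (μ u : ℝ) : ℝ :=
  -(Real.exp (-(μ * √u)) * (μ * √u + 1) / (2 * √u ^ 3))

theorem hasDerivAt_exp_neg_mul_sqrt (μ : ℝ) {u : ℝ} (hu : 0 < u) :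
    HasDerivAt (fun u => Real.exp (-(μ * √u))) (Real.exp (-(μ * √u)) * -(μ * (1 / (2 * √u)))) u :=
  ((Real.hasDerivAt_sqrt hu.ne').const_mul μ).neg.exp

theorem hasDerivAt_yukawa (μ : ℝ) {u : ℝ} (hu : 0 < u) :
    HasDerivAt (yukawa μ) (yukawaDeriv μ u) u := by
  have hs : 0 < √u := Real.sqrt_pos.2 hu
  have h2 := (hasDerivAt_exp_neg_mul_sqrt μ hu).div (Real.hasDerivAt_sqrt hu.ne') hs.ne'
  refine h2.congr_deriv ?_
  unfold yukawaDeriv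
  field_simp
  ring

theorem hasDerivAt_yukawaDeriv (μ : ℝ) {u : ℝ} (hu : 0 < u) :
    HasDerivAt (yukawaDeriv μ) ((μ ^ 2 * yukawa μ u - 6 * yukawaDeriv μ u) / (4 * u)) u := by
  have hs : 0 < √u := Real.sqrt_pos.2 hu
  have h1 := Real.hasDerivAt_sqrt hu.ne'
  have h3 : HasDerivAt (fun u => 2 * √u ^ 3) (2 * (3 * √u ^ 2 * (1 / (2 * √u)))) u := by
    simpa using (h1.fun_pow 3).const_mul 2
  have h2 := (((hasDerivAt_exp_neg_mul_sqrt μ hu).fun_mul ((h1.const_mul μ).add_const 1)).fun_div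
    h3 (by positivity)).fun_neg
  refine h2.congr_deriv ?_
  have hu2 : u = √u ^ 2 := (Real.sq_sqrt hu.le).symm
  unfold yukawaDeriv yukawa
  clear h1 h2 h3
  generalize √u = s at *
  subst hu2
  field_simp
  ring

/-- The smoothly truncated Yukawa profile. -/
noncomputable def profile (μ u : ℝ) : ℝ := cut u * yukawa μ u

theorem profile_eventuallyEq_zero (μ : ℝ) {u : ℝ} (h : u < 1 / 2) :
    profile μ =ᶠ[𝓝 u] fun _ => 0 := by
  filter_upwards [Iio_mem_nhds h] with y hy
  rw [profile, cut_of_le (le_of_lt hy), zero_mul]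

theorem contDiff_profile (μ : ℝ) : ContDiff ℝ ∞ (profile μ) := by
  rw [contDiff_iff_contDiffAt]
  intro u
  rcases lt_or_ge u (1 / 2) with h | h
  · exact contDiffAt_const.congr_of_eventuallyEq (profile_eventuallyEq_zero μ h)
  · have hu : 0 < u := by linarith
    have hs : ContDiffAt ℝ ∞ Real.sqrt u := Real.contDiffAt_sqrt hu.ne'
    exact contDiff_cut.contDiffAt.mul
      (((contDiffAt_const.mul hs).neg.exp).div hs (Real.sqrt_pos.2 hu).ne')

theorem deriv_profile (μ : ℝ) {u : ℝ} (hu : 0 < u) :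
    deriv (profile μ) u = deriv cut u * yukawa μ u + cut u * yukawaDeriv μ u :=
  (((contDiff_cut.differentiable (by simp) u).hasDerivAt).mul (hasDerivAt_yukawa μ hu)).deriv

theorem deriv_deriv_profile (μ : ℝ) {u : ℝ} (hu : 0 < u) :
    deriv (deriv (profile μ)) u = deriv (deriv cut) u * yukawa μ u
      + 2 * deriv cut u * yukawaDeriv μ u
      + cut u * ((μ ^ 2 * yukawa μ u - 6 * yukawaDeriv μ u) / (4 * u)) := by
  have h1 : deriv (profile μ) =ᶠ[𝓝 u]
      fun u => deriv cut u * yukawa μ u + cut u * yukawaDeriv μ u := by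
    filter_upwards [Ioi_mem_nhds hu] with y hy using deriv_profile μ hy
  rw [h1.deriv_eq]
  have hc := (contDiff_cut.differentiable (by simp) u).hasDerivAt
  have hc' := ((contDiff_deriv_infty contDiff_cut).differentiable (by simp) u).hasDerivAt
  have := (hc'.mul (hasDerivAt_yukawa μ hu)).add (hc.mul (hasDerivAt_yukawaDeriv μ hu))
  refine this.deriv.trans ?_
  ring

/-- `μ² g - 4 u g'' - 6 g'` for the profile `g`: only derivatives of the cutoff survive. -/
theorem profile_ode (μ : ℝ) {u : ℝ} (hu : 0 < u) :
    μ ^ 2 * profile μ u - (4 * u * deriv (deriv (profile μ)) u + 6 * deriv (profile μ) u)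
      = -(6 * deriv cut u + 4 * u * deriv (deriv cut) u) * yukawa μ u
        - 8 * u * deriv cut u * yukawaDeriv μ u := by
  rw [deriv_profile μ hu, deriv_deriv_profile μ hu, profile]
  field_simp
  ring

theorem cut_eventuallyEq_one {u : ℝ} (h : 1 < u) : cut =ᶠ[𝓝 u] fun _ => 1 := by
  filter_upwards [Ioi_mem_nhds h] with y hy using cut_of_ge (le_of_lt hy)

theorem deriv_cut_of_gt {u : ℝ} (h : 1 < u) : deriv cut u = 0 := by
  rw [(cut_eventuallyEq_one h).deriv_eq, deriv_const]

theorem deriv_deriv_cut_of_gt {u : ℝ} (h : 1 < u) : deriv (deriv cut) u = 0 := by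
  rw [(cut_eventuallyEq_one h).deriv.deriv_eq]
  simp

/-- The smoothly truncated Yukawa potential on `ℝ³`. -/
noncomputable def truncYukawa (μ : ℝ) (z : E3) : ℝ := profile μ (‖z‖ ^ 2)

/-- The source `(μ² - Δ)` of the truncated Yukawa potential. -/
noncomputable def yukawaSource (μ : ℝ) (z : E3) : ℝ :=
  μ ^ 2 * truncYukawa μ z - lap (truncYukawa μ) z

theorem contDiff_truncYukawa (μ : ℝ) : ContDiff ℝ ∞ (truncYukawa μ) :=
  contDiff_radial (contDiff_profile μ)

theorem contDiff_yukawaSource (μ : ℝ) : ContDiff ℝ ∞ (yukawaSource μ) :=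
  (contDiff_const.mul (contDiff_truncYukawa μ)).sub (contDiff_truncYukawa μ).lap

theorem truncYukawa_nonneg (μ : ℝ) (z : E3) : 0 ≤ truncYukawa μ z :=
  mul_nonneg (Real.smoothTransition.nonneg _) (div_nonneg (Real.exp_pos _).le (Real.sqrt_nonneg _))

theorem truncYukawa_of_ge (μ : ℝ) {z : E3} (hz : 1 ≤ ‖z‖) :
    truncYukawa μ z = Real.exp (-(μ * ‖z‖)) / ‖z‖ := by
  rw [truncYukawa, profile, cut_of_ge (by nlinarith), yukawa, Real.sqrt_sq (norm_nonneg z), one_mul]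

theorem yukawaSource_of_pos (μ : ℝ) {z : E3} (hz : 0 < ‖z‖) :
    yukawaSource μ z = -(6 * deriv cut (‖z‖ ^ 2) + 4 * ‖z‖ ^ 2 * deriv (deriv cut) (‖z‖ ^ 2))
        * yukawa μ (‖z‖ ^ 2) - 8 * ‖z‖ ^ 2 * deriv cut (‖z‖ ^ 2) * yukawaDeriv μ (‖z‖ ^ 2) := by
  rw [← profile_ode μ (by positivity)]
  unfold yukawaSource truncYukawa
  rw [lap_radial (contDiff_profile μ)]

theorem yukawaSource_of_gt (μ : ℝ) {z : E3} (hz : 1 < ‖z‖) : yukawaSource μ z = 0 := by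
  have h : 1 < ‖z‖ ^ 2 := by nlinarith
  rw [yukawaSource_of_pos μ (by linarith), deriv_cut_of_gt h, deriv_deriv_cut_of_gt h]
  ring

theorem yukawaSource_of_small (μ : ℝ) {z : E3} (hz : ‖z‖ ^ 2 < 1 / 2) : yukawaSource μ z = 0 := by
  have h := profile_eventuallyEq_zero μ hz
  unfold yukawaSource truncYukawa
  rw [lap_radial (contDiff_profile μ)]
  simp only [h.eq_of_nhds, h.deriv_eq, h.deriv.deriv_eq]
  simp

theorem hasCompactSupport_yukawaSource (μ : ℝ) : HasCompactSupport (yukawaSource μ) := by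
  refine HasCompactSupport.intro (isCompact_closedBall (0 : E3) 1) fun z hz => ?_
  rw [mem_closedBall_zero_iff, not_le] at hz
  exact yukawaSource_of_gt μ hz

theorem exists_bound_yukawaSource : ∃ C : ℝ, 0 < C ∧ ∀ μ : ℝ, 0 < μ → μ ≤ 1 → ∀ z,
    |yukawaSource μ z| ≤ C := by
  have hk : IsCompact (Set.Icc (0 : ℝ) 1) := isCompact_Icc
  obtain ⟨A, hA⟩ := hk.exists_bound_of_continuousOn
    (contDiff_deriv_infty contDiff_cut).continuous.continuousOn
  obtain ⟨B, hB⟩ := hk.exists_bound_of_continuousOn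
    (contDiff_deriv_infty (contDiff_deriv_infty contDiff_cut)).continuous.continuousOn
  have hA0 : 0 ≤ A := (norm_nonneg _).trans (hA 0 (by simp))
  have hB0 : 0 ≤ B := (norm_nonneg _).trans (hB 0 (by simp))
  refine ⟨(6 * A + 4 * B) * 2 + 8 * A * 8 + 1, by positivity, fun μ hμ hμ1 z => ?_⟩
  rcases lt_or_ge (‖z‖ ^ 2) (1 / 2) with h | h
  · rw [yukawaSource_of_small μ h, abs_zero]
    positivity
  rcases lt_or_ge 1 ‖z‖ with h' | h'
  · rw [yukawaSource_of_gt μ h', abs_zero]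
    positivity
  have hs : 1 / 2 ≤ ‖z‖ := by nlinarith [norm_nonneg z]
  have hs0 : 0 < ‖z‖ := by linarith
  rw [yukawaSource_of_pos μ hs0]
  have hu1 : ‖z‖ ^ 2 ≤ 1 := by nlinarith
  have hu : ‖z‖ ^ 2 ∈ Set.Icc (0 : ℝ) 1 := ⟨by positivity, hu1⟩
  have hA' := hA _ hu
  have hB' := hB _ hu
  rw [Real.norm_eq_abs] at hA' hB'
  have hE : Real.exp (-(μ * ‖z‖)) ≤ 1 := Real.exp_le_one_iff.2 (by nlinarith)
  have hE0 := (Real.exp_pos (-(μ * ‖z‖))).le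
  have hy : |yukawa μ (‖z‖ ^ 2)| ≤ 2 := by
    rw [yukawa, Real.sqrt_sq hs0.le, abs_of_nonneg (by positivity), div_le_iff₀ hs0]
    linarith
  have hy' : |yukawaDeriv μ (‖z‖ ^ 2)| ≤ 8 := by
    rw [yukawaDeriv, Real.sqrt_sq hs0.le, abs_neg, abs_of_nonneg (by positivity),
      div_le_iff₀ (by positivity)]
    have h1 : Real.exp (-(μ * ‖z‖)) * (μ * ‖z‖ + 1) ≤ 1 * 2 := by
      apply mul_le_mul hE _ (by positivity) zero_le_one
      nlinarith
    have h2 : (1 / 2 : ℝ) ^ 3 ≤ ‖z‖ ^ 3 := by gcongr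
    linarith
  have hu0 : |‖z‖ ^ 2| ≤ 1 := by rw [abs_of_nonneg hu.1]; exact hu1
  set D1 := deriv cut (‖z‖ ^ 2)
  set D2 := deriv (deriv cut) (‖z‖ ^ 2)
  set Y := yukawa μ (‖z‖ ^ 2)
  set Y' := yukawaDeriv μ (‖z‖ ^ 2)
  have t1 : |6 * D1 + 4 * ‖z‖ ^ 2 * D2| ≤ 6 * A + 4 * B := by
    refine (abs_add_le _ _).trans ?_
    rw [abs_mul, abs_mul, abs_mul, abs_of_pos (by norm_num : (0:ℝ) < 6),
      abs_of_pos (by norm_num : (0:ℝ) < 4)]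
    nlinarith [abs_nonneg D2]
  have t2 : |8 * ‖z‖ ^ 2 * D1| ≤ 8 * A := by
    rw [abs_mul, abs_mul, abs_of_pos (by norm_num : (0:ℝ) < 8)]
    nlinarith [abs_nonneg D1]
  refine (abs_sub _ _).trans ?_
  rw [abs_mul, abs_mul, abs_neg]
  have t3 := mul_le_mul t1 hy (abs_nonneg _) (by positivity)
  have t4 := mul_le_mul t2 hy' (abs_nonneg _) (by positivity)
  linarith

theorem integrable_exp_neg_mul_norm {μ : ℝ} (hμ : 0 < μ) :
    Integrable (fun z : E3 => Real.exp (-(μ * ‖z‖))) volume := by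
  have h := (integrable_fun_norm_addHaar (volume : Measure E3)
    (f := fun r : ℝ => Real.exp (-(μ * r)))).2
  refine h ?_
  have h2 := integrableOn_rpow_mul_exp_neg_mul_rpow (p := 1) (s := 2) (by norm_num) one_pos hμ
  refine h2.congr_fun (fun r hr => ?_) measurableSet_Ioi
  simp

theorem memLp_exp_neg_mul_norm {μ : ℝ} (hμ : 0 < μ) :
    MemLp (fun z : E3 => Real.exp (-(μ * ‖z‖))) 2 volume := by
  rw [memLp_two_iff_integrable_sq (by fun_prop)]
  refine (integrable_exp_neg_mul_norm (μ := 2 * μ) (by positivity)).congr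
    (Eventually.of_forall fun z => ?_)
  simp only [← Real.exp_nat_mul]
  congr 1
  push_cast
  ring

/-- A continuous function dominated by `e^{-μ|z|}` outside the unit ball is dominated by it
everywhere. -/
theorem exists_bound_exp {F : E3 → ℝ} (hF : Continuous F) {μ C : ℝ} (hμ : 0 < μ)
    (h : ∀ z, 1 < ‖z‖ → |F z| ≤ C * Real.exp (-(μ * ‖z‖))) :
    ∃ C', ∀ z, |F z| ≤ C' * Real.exp (-(μ * ‖z‖)) := by
  obtain ⟨A, hA⟩ := (isCompact_closedBall (0 : E3) 1).exists_bound_of_continuousOn hF.continuousOn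
  have hA0 : 0 ≤ A := (norm_nonneg _).trans (hA 0 (by simp))
  refine ⟨max C (A * Real.exp μ), fun z => ?_⟩
  rcases lt_or_ge 1 ‖z‖ with hz | hz
  · exact (h z hz).trans (by gcongr; exact le_max_left _ _)
  · calc |F z| ≤ A := hA z (by simpa using hz)
      _ ≤ A * (Real.exp μ * Real.exp (-(μ * ‖z‖))) := by
        rw [← Real.exp_add]
        exact le_mul_of_one_le_right hA0 (Real.one_le_exp (by nlinarith))
      _ = (A * Real.exp μ) * Real.exp (-(μ * ‖z‖)) := by ring
      _ ≤ _ := by gcongr; exact le_max_right _ _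

theorem memLp_of_exp_decay {F : E3 → ℝ} (hF : Continuous F) {μ C : ℝ} (hμ : 0 < μ)
    (h : ∀ z, 1 < ‖z‖ → |F z| ≤ C * Real.exp (-(μ * ‖z‖))) : MemLp F 2 volume := by
  obtain ⟨C', hC'⟩ := exists_bound_exp hF hμ h
  refine (memLp_exp_neg_mul_norm hμ).of_le_mul (c := C') hF.aestronglyMeasurable
    (Eventually.of_forall fun z => ?_)
  rw [Real.norm_eq_abs, Real.norm_eq_abs, abs_of_pos (Real.exp_pos _)]
  exact hC' z

theorem integrable_of_exp_decay {F : E3 → ℝ} (hF : Continuous F) {μ C : ℝ} (hμ : 0 < μ)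
    (h : ∀ z, 1 < ‖z‖ → |F z| ≤ C * Real.exp (-(μ * ‖z‖))) : Integrable F volume := by
  obtain ⟨C', hC'⟩ := exists_bound_exp hF hμ h
  refine ((integrable_exp_neg_mul_norm hμ).const_mul C').mono' hF.aestronglyMeasurable
    (Eventually.of_forall hC')

theorem abs_truncYukawa_le {μ : ℝ} {z : E3} (hz : 1 < ‖z‖) :
    |truncYukawa μ z| ≤ 1 * Real.exp (-(μ * ‖z‖)) := by
  rw [truncYukawa_of_ge μ hz.le, abs_of_nonneg (by positivity), one_mul]
  exact div_le_self (Real.exp_pos _).le hz.le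

theorem deriv_profile_of_gt (μ : ℝ) {s : ℝ} (hs : 1 < s) :
    deriv (profile μ) (s ^ 2) = -(Real.exp (-(μ * s)) * (μ * s + 1) / (2 * s ^ 3)) := by
  have h : 1 < s ^ 2 := by nlinarith
  rw [deriv_profile μ (by positivity), deriv_cut_of_gt h, cut_of_ge h.le, yukawaDeriv,
    Real.sqrt_sq (by linarith)]
  ring

theorem abs_pd_truncYukawa_le {μ : ℝ} (hμ : 0 < μ) {z : E3} (hz : 1 < ‖z‖) (e : E3) :
    |pd e (truncYukawa μ) z| ≤ Real.exp (-(μ * ‖z‖)) * (μ / ‖z‖ + 1 / ‖z‖ ^ 2) * ‖e‖ := by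
  have h1 : pd e (truncYukawa μ) z = _ := congrFun (pd_radial (contDiff_profile μ) e) z
  have hz0 : 0 < ‖z‖ := by linarith
  rw [h1, deriv_profile_of_gt μ hz, abs_mul]
  have h2 : |2 * -(Real.exp (-(μ * ‖z‖)) * (μ * ‖z‖ + 1) / (2 * ‖z‖ ^ 3))|
      = Real.exp (-(μ * ‖z‖)) * (μ / ‖z‖ + 1 / ‖z‖ ^ 2) / ‖z‖ := by
    rw [mul_neg, abs_neg, abs_of_nonneg (by positivity)]
    field_simp
  rw [h2]
  calc _ ≤ Real.exp (-(μ * ‖z‖)) * (μ / ‖z‖ + 1 / ‖z‖ ^ 2) / ‖z‖ * (‖z‖ * ‖e‖) := by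
        gcongr
        exact abs_real_inner_le_norm z e
    _ = _ := by field_simp

theorem abs_pd_truncYukawa_le' {μ : ℝ} (hμ : 0 < μ) {z : E3} (hz : 1 < ‖z‖) (e : E3) :
    |pd e (truncYukawa μ) z| ≤ ((μ + 1) * ‖e‖) * Real.exp (-(μ * ‖z‖)) := by
  refine (abs_pd_truncYukawa_le hμ hz e).trans ?_
  have h1 : μ / ‖z‖ ≤ μ := div_le_self hμ.le hz.le
  have h2 : 1 / ‖z‖ ^ 2 ≤ 1 := div_le_self zero_le_one (by nlinarith)
  calc _ ≤ Real.exp (-(μ * ‖z‖)) * (μ + 1) * ‖e‖ := by gcongr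
    _ = _ := by ring

theorem lap_truncYukawa_of_gt (μ : ℝ) {z : E3} (hz : 1 < ‖z‖) :
    lap (truncYukawa μ) z = μ ^ 2 * truncYukawa μ z := by
  have := yukawaSource_of_gt μ hz
  unfold yukawaSource at this
  linarith

theorem abs_lap_truncYukawa_le {μ : ℝ} {z : E3} (hz : 1 < ‖z‖) :
    |lap (truncYukawa μ) z| ≤ μ ^ 2 * Real.exp (-(μ * ‖z‖)) := by
  rw [lap_truncYukawa_of_gt μ hz, abs_mul, abs_of_nonneg (sq_nonneg μ)]
  have := abs_truncYukawa_le (μ := μ) hz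
  rw [one_mul] at this
  gcongr

theorem abs_pd_pd_truncYukawa_le {μ : ℝ} (hμ : 0 < μ) {z : E3} (hz : 1 < ‖z‖) (e : E3) :
    |pd e (pd e (truncYukawa μ)) z|
      ≤ ((μ ^ 2 + 8 * (μ + 1)) * ‖e‖ ^ 2) * Real.exp (-(μ * ‖z‖)) := by
  have h1 : pd e (pd e (truncYukawa μ)) z = _ := congrFun (pd_pd_radial (contDiff_profile μ) e) z
  have hu : 1 < ‖z‖ ^ 2 := by nlinarith
  have hz0 : 0 < ‖z‖ := by linarith
  have hg' := deriv_profile_of_gt μ hz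
  have hg : profile μ (‖z‖ ^ 2) = Real.exp (-(μ * ‖z‖)) / ‖z‖ := truncYukawa_of_ge μ hz.le
  have hode := profile_ode μ (u := ‖z‖ ^ 2) (by positivity)
  rw [deriv_cut_of_gt hu, deriv_deriv_cut_of_gt hu] at hode
  rw [h1]
  set E := Real.exp (-(μ * ‖z‖))
  have hE : 0 < E := Real.exp_pos _
  have hb : |profile μ (‖z‖ ^ 2)| ≤ E := by
    rw [hg, abs_of_nonneg (by positivity)]
    exact div_le_self hE.le hz.le
  have hb' : |deriv (profile μ) (‖z‖ ^ 2)| ≤ (μ + 1) * E := by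
    rw [hg', abs_neg, abs_of_nonneg (by positivity), div_le_iff₀ (by positivity)]
    have h3 : ‖z‖ ≤ ‖z‖ ^ 3 := by nlinarith [mul_pos hz0 hz0]
    have h4 : (1 : ℝ) ≤ ‖z‖ ^ 3 := by linarith
    have h5 : μ * ‖z‖ + 1 ≤ (μ + 1) * (2 * ‖z‖ ^ 3) := by nlinarith
    nlinarith
  have hin : inner ℝ z e ^ 2 ≤ ‖z‖ ^ 2 * ‖e‖ ^ 2 := by
    rw [← mul_pow, ← sq_abs]
    exact pow_le_pow_left₀ (abs_nonneg _) (abs_real_inner_le_norm z e) 2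
  set g' := deriv (profile μ) (‖z‖ ^ 2)
  set g'' := deriv (deriv (profile μ)) (‖z‖ ^ 2)
  have hb'' : 4 * ‖z‖ ^ 2 * |g''| ≤ (μ ^ 2 + 6 * (μ + 1)) * E := by
    have h6 : 4 * ‖z‖ ^ 2 * |g''| = |μ ^ 2 * profile μ (‖z‖ ^ 2) - 6 * g'| := by
      have h7 : μ ^ 2 * profile μ (‖z‖ ^ 2) - 6 * g' = 4 * ‖z‖ ^ 2 * g'' := by linarith
      rw [h7, abs_mul, abs_of_pos (by positivity : 0 < 4 * ‖z‖ ^ 2)]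
    rw [h6]
    refine (abs_sub _ _).trans ?_
    rw [abs_mul, abs_mul, abs_of_nonneg (sq_nonneg μ), abs_of_pos (by norm_num : (0 : ℝ) < 6)]
    nlinarith [mul_le_mul_of_nonneg_left hb (sq_nonneg μ)]
  refine (abs_add_le _ _).trans ?_
  rw [abs_mul, abs_mul, abs_mul, abs_mul, abs_of_nonneg (sq_nonneg (inner ℝ z e)),
    abs_of_nonneg (sq_nonneg ‖e‖), abs_of_pos (by norm_num : (0 : ℝ) < 4),
    abs_of_pos (by norm_num : (0 : ℝ) < 2)]
  calc 4 * |g''| * inner ℝ z e ^ 2 + 2 * |g'| * ‖e‖ ^ 2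
      ≤ 4 * |g''| * (‖z‖ ^ 2 * ‖e‖ ^ 2) + 2 * ((μ + 1) * E) * ‖e‖ ^ 2 := by gcongr
    _ = (4 * ‖z‖ ^ 2 * |g''|) * ‖e‖ ^ 2 + 2 * ((μ + 1) * E) * ‖e‖ ^ 2 := by ring
    _ ≤ ((μ ^ 2 + 6 * (μ + 1)) * E) * ‖e‖ ^ 2 + 2 * ((μ + 1) * E) * ‖e‖ ^ 2 := by gcongr
    _ = _ := by ring

theorem integral_pd_eq_zero {F : E3 → ℝ} (hF : ContDiff ℝ ∞ F) (e : E3) (h0 : Integrable F volume)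
    (h1 : Integrable (pd e F) volume) : ∫ x, pd e F x = 0 := by
  have := integral_mul_fderiv_eq_neg_fderiv_mul_of_integrable (μ := (volume : Measure E3))
    (f := fun _ : E3 => (1 : ℝ)) (g := F) (v := e) (by simp) (by simpa using (show Integrable (fun x => fderiv ℝ F x e) volume from h1)) (by simpa using h0)
    (fun x _ => differentiableAt_const _) (fun x _ => hF.differentiable_infty x)
  simpa [pd] using this

theorem integrable_truncYukawa {μ : ℝ} (hμ : 0 < μ) : Integrable (truncYukawa μ) volume :=
  integrable_of_exp_decay (contDiff_truncYukawa μ).continuous hμ fun _ hz => abs_truncYukawa_le hz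

theorem integral_lap_truncYukawa {μ : ℝ} (hμ : 0 < μ) :
    Integrable (lap (truncYukawa μ)) volume ∧ ∫ z, lap (truncYukawa μ) z = 0 := by
  have hs := contDiff_truncYukawa μ
  have hi : ∀ i : Fin 3, Integrable (pd (unitVec i) (pd (unitVec i) (truncYukawa μ))) volume :=
    fun i => integrable_of_exp_decay ((hs.pd _).pd _).continuous hμ
      fun z hz => abs_pd_pd_truncYukawa_le hμ hz (unitVec i)
  refine ⟨integrable_finsetSum _ fun i _ => hi i, ?_⟩
  unfold lap
  rw [integral_finsetSum _ fun i _ => hi i]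
  refine Finset.sum_eq_zero fun i _ => integral_pd_eq_zero (hs.pd _) _ ?_ (hi i)
  exact integrable_of_exp_decay (hs.pd _).continuous hμ
      fun z hz => abs_pd_truncYukawa_le' hμ hz (unitVec i)

theorem volume_real_closedBall (x : E3) {r : ℝ} (hr : 0 ≤ r) :
    (volume : Measure E3).real (Metric.closedBall x r)
      = r ^ 3 * (volume : Measure E3).real (Metric.ball 0 1) := by
  rw [Measure.addHaar_real_closedBall _ _ hr]
  simp

theorem volume_real_unitBall_pos : 0 < (volume : Measure E3).real (Metric.ball 0 1) :=
  ENNReal.toReal_pos (Metric.measure_ball_pos _ _ one_pos).ne' measure_ball_lt_top.ne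

theorem const_mul_le_setIntegral_closedBall {F : E3 → ℝ} (hF : Integrable F volume) {a : E3} {r m : ℝ}
    (hr : 0 ≤ r) (h : ∀ᵐ x : E3, x ∈ Metric.closedBall a r → m ≤ F x) :
    m * (r ^ 3 * (volume : Measure E3).real (Metric.ball 0 1))
      ≤ ∫ x in Metric.closedBall a r, F x := by
  have := setIntegral_mono_on_ae (μ := volume) (s := Metric.closedBall a r) (f := fun _ => m)
    (g := F) (integrableOn_const measure_closedBall_lt_top.ne) hF.integrableOn
    measurableSet_closedBall h
  rw [setIntegral_const, volume_real_closedBall a hr, smul_eq_mul] at this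
  linarith

theorem exists_integral_yukawaSource_ge : ∃ κ : ℝ, 0 < κ ∧ ∀ μ : ℝ, 0 < μ → μ ≤ 1 →
    κ ≤ ∫ z, yukawaSource μ z := by
  set V := (volume : Measure E3).real (Metric.ball 0 1)
  have hV : 0 < V := volume_real_unitBall_pos
  refine ⟨Real.exp (-4) / 4 * V, by positivity, fun μ hμ hμ1 => ?_⟩
  have hinteg := integrable_truncYukawa hμ
  have h1 : ∫ z, yukawaSource μ z = μ ^ 2 * ∫ z, truncYukawa μ z := by
    unfold yukawaSource
    rw [integral_sub (hinteg.const_mul _) (integral_lap_truncYukawa hμ).1,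
      (integral_lap_truncYukawa hμ).2, integral_const_mul, sub_zero]
  rw [h1]
  set a : E3 := (3 / μ) • unitVec 0
  have ha : ‖a‖ = 3 / μ := by
    simp only [a, norm_smul, Real.norm_eq_abs]
    rw [abs_of_pos (by positivity)]
    simp
  have h2 : ∀ z ∈ Metric.closedBall a (1 / μ), Real.exp (-4) * μ / 4 ≤ truncYukawa μ z := by
    intro z hz
    rw [mem_closedBall_iff_norm] at hz
    have hlo : 2 / μ ≤ ‖z‖ := by
      have := norm_sub_norm_le a (a - z)
      rw [sub_sub_cancel, ha, norm_sub_rev] at this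
      have h3 : 3 / μ = 2 / μ + 1 / μ := by ring
      linarith
    have hhi : ‖z‖ ≤ 4 / μ := by
      have := norm_add_le a (z - a)
      rw [add_sub_cancel, ha] at this
      have h3 : 4 / μ = 3 / μ + 1 / μ := by ring
      linarith
    have h1μ : 1 ≤ 2 / μ := by rw [le_div_iff₀ hμ]; linarith
    have hz0 : 0 < ‖z‖ := by linarith
    rw [truncYukawa_of_ge μ (h1μ.trans hlo), le_div_iff₀ hz0]
    rw [le_div_iff₀ hμ] at hhi
    have h4 : Real.exp (-4) ≤ Real.exp (-(μ * ‖z‖)) := Real.exp_le_exp.2 (by linarith)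
    have h5 : Real.exp (-4) * μ / 4 * ‖z‖ = Real.exp (-4) * (‖z‖ * μ / 4) := by ring
    rw [h5]
    calc _ ≤ Real.exp (-4) * 1 := by gcongr; linarith
      _ ≤ _ := by linarith
  have h3 := const_mul_le_setIntegral_closedBall hinteg (by positivity : 0 ≤ 1 / μ)
    (Eventually.of_forall h2)
  have h4 := setIntegral_le_integral (s := Metric.closedBall a (1 / μ)) hinteg
    (Eventually.of_forall (truncYukawa_nonneg μ))
  calc Real.exp (-4) / 4 * V = μ ^ 2 * (Real.exp (-4) * μ / 4 * ((1 / μ) ^ 3 * V)) := by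
        field_simp
    _ ≤ _ := by gcongr; exact h3.trans h4

/-- `S` contains, near `x`, a family of closed balls shrinking to `x` with radii comparable to their
distance from `x`. -/
def HasInnerBalls (S : Set E3) (x : E3) : Prop :=
  ∃ (n : E3) (h ρ : ℝ), ‖n‖ ≤ 1 ∧ 0 < h ∧ 0 < ρ ∧ ρ ≤ 1 ∧
    ∀ t, 0 < t → t ≤ h → Metric.closedBall (x + t • n) (t * ρ) ⊆ S

theorem hasInnerBalls_of_mem_interior {S : Set E3} {x : E3} (hx : x ∈ interior S) :
    HasInnerBalls S x := by
  obtain ⟨r, hr, hsub⟩ := Metric.isOpen_iff.1 isOpen_interior x hx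
  refine ⟨0, r / 2, 1, by simp, by positivity, one_pos, le_rfl, fun t _ ht => ?_⟩
  rw [smul_zero, add_zero, mul_one]
  exact (Metric.closedBall_subset_ball (by linarith)).trans (hsub.trans interior_subset)

theorem ConeCondition.hasInnerBalls {S : Set E3} (hS : ConeCondition S) {x : E3}
    (hx : x ∈ frontier S) : HasInnerBalls S x := by
  obtain ⟨n, h, θ, hn, hh, hθ0, hθπ, hsub⟩ := hS x hx
  have hc1 : Real.cos θ < 1 := by
    have := Real.cos_lt_cos_of_nonneg_of_le_pi le_rfl hθπ.le hθ0
    rwa [Real.cos_zero] at this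
  have hc2 : -1 < Real.cos θ := by
    have := Real.cos_lt_cos_of_nonneg_of_le_pi hθ0.le le_rfl hθπ
    rwa [Real.cos_pi] at this
  set c := Real.cos θ
  refine ⟨n, h / 2, (1 - c) / 2, hn.le, by positivity, by linarith, by linarith, ?_⟩
  intro t ht0 ht y hy
  rw [mem_closedBall_iff_norm] at hy
  set u := y - (x + t • n) with hu
  have hyx : y - x = t • n + u := by rw [hu]; abel
  have htn : ‖t • n‖ = t := by rw [norm_smul, hn, Real.norm_eq_abs, abs_of_pos ht0, mul_one]
  have hup : ‖y - x‖ ≤ t + ‖u‖ := by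
    rw [hyx]
    exact (norm_add_le _ _).trans (by rw [htn])
  have hlo : t - ‖u‖ ≤ ‖y - x‖ := by
    have := norm_sub_norm_le (t • n) (-u)
    rw [norm_neg, sub_neg_eq_add, htn, ← hyx] at this
    exact this
  have hin : t - ‖u‖ ≤ inner ℝ (y - x) n := by
    rw [hyx, inner_add_left, inner_smul_left, real_inner_self_eq_norm_sq, hn]
    have := abs_real_inner_le_norm u n
    rw [hn, mul_one] at this
    have h2 := neg_abs_le (inner ℝ u n)
    simp
    linarith
  have hρ : (1 - c) / 2 < 1 := by linarith
  have hρt : t * ((1 - c) / 2) < t := by nlinarith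
  apply hsub
  refine ⟨⟨by linarith, ?_⟩, ?_⟩
  · refine le_trans ?_ hin
    rcases le_or_gt 0 c with hc | hc
    · have h1 : ‖y - x‖ * c ≤ (t + ‖u‖) * c := mul_le_mul_of_nonneg_right hup hc
      have h2 : (1 + c) * ‖u‖ ≤ (1 + c) * (t * ((1 - c) / 2)) :=
        mul_le_mul_of_nonneg_left hy (by linarith)
      have h3 : (1 + c) * (t * ((1 - c) / 2)) ≤ t * (1 - c) := by
        have : 0 ≤ t * (1 - c) * (1 - c) := by
          have := sq_nonneg (1 - c)
          nlinarith
        nlinarith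
      nlinarith
    · have h1 : ‖y - x‖ * c ≤ 0 := mul_nonpos_of_nonneg_of_nonpos (norm_nonneg _) hc.le
      linarith
  · intro hyx'
    rw [Set.mem_singleton_iff] at hyx'
    rw [hyx', sub_self, norm_zero] at hlo
    linarith

theorem HasC1Boundary.hasInnerBalls {S : Set E3} (hS : HasC1Boundary S) {x : E3}
    (hx : x ∈ frontier S) : HasInnerBalls S x := by
  obtain ⟨U, φ, hU, hxU, hφ, hne, hin, hout⟩ := hS x hx
  have hφat : ContDiffAt ℝ 1 φ x := hφ.contDiffAt (hU.mem_nhds hxU)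
  have hdiff : DifferentiableAt ℝ φ x := hφat.differentiableAt (by simp)
  have hφx : φ x ≤ 0 := by
    have hcl : x ∈ closure (U ∩ S) := hU.inter_closure ⟨hxU, frontier_subset_closure hx⟩
    have hne' : (𝓝[U ∩ S] x).NeBot := mem_closure_iff_nhdsWithin_neBot.1 hcl
    refine le_of_tendsto (x := 𝓝[U ∩ S] x) (hφat.continuousAt.tendsto.mono_left nhdsWithin_le_nhds) ?_
    filter_upwards [self_mem_nhdsWithin] with y hy using hout y hy.1 hy.2
  set L := fderiv ℝ φ x with hL
  obtain ⟨n, hn, hLn⟩ : ∃ n : E3, ‖n‖ ≤ 1 ∧ L n < 0 := by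
    obtain ⟨w, hw⟩ : ∃ w, L w ≠ 0 := by
      by_contra! hcon
      exact hne (ContinuousLinearMap.ext hcon)
    have hw0 : w ≠ 0 := by rintro rfl; simp at hw
    have hwn : 0 < ‖w‖ := norm_pos_iff.2 hw0
    rcases lt_or_gt_of_ne hw with h | h
    · refine ⟨‖w‖⁻¹ • w, by rw [norm_smul, norm_inv, norm_norm, inv_mul_cancel₀ hwn.ne'], ?_⟩
      rw [map_smul, smul_eq_mul]
      exact mul_neg_of_pos_of_neg (by positivity) h
    · refine ⟨-(‖w‖⁻¹ • w), by rw [norm_neg, norm_smul, norm_inv, norm_norm,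
        inv_mul_cancel₀ hwn.ne'], ?_⟩
      rw [map_neg, map_smul, smul_eq_mul]
      have : 0 < ‖w‖⁻¹ * L w := by positivity
      linarith
  set m := -L n with hm
  have hm0 : 0 < m := by linarith
  have hLnorm : 0 ≤ ‖L‖ := norm_nonneg L
  set ρ := min 1 (m / (4 * (‖L‖ + 1))) with hρ
  have hρ0 : 0 < ρ := lt_min one_pos (by positivity)
  have hρ1 : ρ ≤ 1 := min_le_left _ _
  have hLρ : ‖L‖ * ρ ≤ m / 4 := by
    have h1 : ρ ≤ m / (4 * (‖L‖ + 1)) := min_le_right _ _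
    rw [le_div_iff₀ (by positivity)] at h1
    nlinarith
  have hlit := hdiff.hasFDerivAt.isLittleO.def (c := m / 8) (by positivity)
  obtain ⟨r, hr, hball⟩ := Metric.eventually_nhds_iff.1 (hlit.and (hU.mem_nhds hxU))
  refine ⟨n, r / 4, ρ, hn, by positivity, hρ0, hρ1, fun t ht0 ht y hy => ?_⟩
  rw [mem_closedBall_iff_norm] at hy
  set u := y - (x + t • n) with hu
  have hyx : y - x = t • n + u := by rw [hu]; abel
  have htn : ‖t • n‖ ≤ t := by
    rw [norm_smul, Real.norm_eq_abs, abs_of_pos ht0]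
    nlinarith
  have hup : ‖y - x‖ ≤ 2 * t := by
    rw [hyx]
    have := norm_add_le (t • n) u
    nlinarith
  obtain ⟨hest, hyU⟩ := hball (y := y) (by rw [dist_eq_norm]; linarith)
  apply hin y hyU
  have h1 : L (y - x) ≤ -(t * m) + t * (m / 4) := by
    rw [hyx, map_add, map_smul, smul_eq_mul]
    have h2 : L u ≤ ‖L‖ * ‖u‖ := (le_abs_self _).trans (L.le_opNorm u)
    have h3 : ‖L‖ * ‖u‖ ≤ ‖L‖ * (t * ρ) := mul_le_mul_of_nonneg_left hy hLnorm
    have h4 : ‖L‖ * (t * ρ) ≤ t * (m / 4) := by nlinarith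
    have h5 : t * L n = -(t * m) := by rw [hm]; ring
    linarith
  have h2 : φ y - φ x - L (y - x) ≤ m / 8 * (2 * t) :=
    (le_abs_self _).trans (hest.trans (mul_le_mul_of_nonneg_left hup (by positivity)))
  nlinarith

theorem volume_frontier_eq_zero {B : Set E3} (hB : IsOpen B) (hcone : ConeCondition B) :
    volume (frontier B) = 0 := by
  have hms : MeasurableSet (frontier B) := isClosed_frontier.measurableSet
  have h1 := Besicovitch.ae_tendsto_measure_inter_div_of_measurableSet (volume : Measure E3) hms
  rw [measure_eq_zero_iff_ae_notMem]
  filter_upwards [h1] with x hx hxF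
  rw [Set.indicator_of_mem hxF] at hx
  obtain ⟨n, h, ρ, hn, hh, hρ0, hρ1, hsub⟩ := hcone.hasInnerBalls hxF
  set c : ENNReal := ENNReal.ofReal ((ρ / 2) ^ 3)
  have hc : 0 < c := ENNReal.ofReal_pos.2 (by positivity)
  have hle : ∀ᶠ r in 𝓝[>] (0 : ℝ), volume (frontier B ∩ Metric.closedBall x r)
      / volume (Metric.closedBall x r) + c ≤ 1 := by
    filter_upwards [Ioo_mem_nhdsGT hh] with r hr
    have hr0 : 0 < r := hr.1
    have hvol0 : volume (Metric.closedBall x r) ≠ 0 := (Metric.measure_closedBall_pos _ _ hr0).ne'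
    have hvolt : volume (Metric.closedBall x r) ≠ ⊤ := measure_closedBall_lt_top.ne
    set Q := Metric.closedBall (x + (r / 2) • n) (r / 2 * ρ) with hQ
    have hQB : Q ⊆ B := hsub (r / 2) (by positivity) (by linarith [hr.2])
    have hQr : Q ⊆ Metric.closedBall x r := by
      apply Metric.closedBall_subset_closedBall'
      rw [dist_eq_norm, add_sub_cancel_left, norm_smul, Real.norm_eq_abs,
        abs_of_pos (by positivity)]
      nlinarith
    have hQvol : volume Q / volume (Metric.closedBall x r) = c := by
      rw [hQ, Measure.addHaar_closedBall _ _ (by positivity),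
        Measure.addHaar_closedBall _ _ hr0.le]
      rw [ENNReal.mul_div_mul_right _ _ (Metric.measure_ball_pos _ _ one_pos).ne'
        measure_ball_lt_top.ne, ← ENNReal.ofReal_div_of_pos (by positivity)]
      congr 1
      simp
      field_simp
    rw [← hQvol, ← ENNReal.add_div]
    refine ENNReal.div_le_of_le_mul ?_
    rw [one_mul, ← measure_union _ Metric.isClosed_closedBall.measurableSet]
    · exact measure_mono (Set.union_subset Set.inter_subset_right hQr)
    · refine Set.disjoint_left.2 fun y hy hyQ => ?_
      exact (hB.frontier_eq ▸ hy.1).2 (hQB hyQ)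
  have hlim := le_of_tendsto (hx.add_const c) hle
  have : (1 : ENNReal) < 1 + c := ENNReal.lt_add_right ENNReal.one_ne_top hc.ne'
  exact absurd hlim (not_le.2 this)

theorem setDist_le_of_mem {D B : Set E3} {x y : E3} (hx : x ∈ D) (hy : y ∈ B) :
    setDist D B ≤ ‖x - y‖ := by
  refine csInf_le ⟨0, ?_⟩ ⟨x, hx, y, hy, rfl⟩
  rintro r ⟨a, _, b, _, rfl⟩
  exact norm_nonneg _

theorem setDist_le {D B : Set E3} {x y : E3} (hx : x ∈ closure D) (hy : y ∈ closure B) :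
    setDist D B ≤ ‖x - y‖ := by
  have h1 : ∀ a ∈ D, ∀ b ∈ closure B, setDist D B ≤ ‖a - b‖ := fun a ha b hb =>
    le_on_closure (f := fun _ => setDist D B) (g := fun b => ‖a - b‖)
      (fun b hb => setDist_le_of_mem ha hb) continuousOn_const (by fun_prop) hb
  exact le_on_closure (f := fun _ => setDist D B) (g := fun a => ‖a - y‖)
    (fun a ha => h1 a ha y hy) continuousOn_const (by fun_prop) hx

theorem exists_setDist_eq {D B : Set E3} (hD : Bornology.IsBounded D) (hDne : D.Nonempty)
    (hBne : B.Nonempty) :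
    ∃ p ∈ closure D, ∃ q ∈ closure B, ‖p - q‖ = setDist D B := by
  have hcD : IsCompact (closure D) := hD.isCompact_closure
  obtain ⟨p, hp, hmin⟩ := hcD.exists_isMinOn hDne.closure
    (Metric.continuous_infDist_pt (closure B)).continuousOn
  obtain ⟨q, hq, hpq⟩ := isClosed_closure.exists_infDist_eq_dist hBne.closure p
  refine ⟨p, hp, q, hq, le_antisymm ?_ (setDist_le hp hq)⟩
  obtain ⟨a, ha⟩ := hDne
  obtain ⟨b, hb⟩ := hBne
  refine le_csInf ⟨_, a, ha, b, hb, rfl⟩ ?_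
  rintro r ⟨x, hx, y, hy, rfl⟩
  rw [← dist_eq_norm, ← dist_eq_norm, ← hpq]
  exact (isMinOn_iff.1 hmin x (subset_closure hx)).trans
    (Metric.infDist_le_dist_of_mem (subset_closure hy))

theorem memLp_comp_smul_sub {F : E3 → ℝ} (hF : MemLp F 2 volume) (hFc : Continuous F) (a : E3)
    {c : ℝ} (hc : c ≠ 0) : MemLp (fun x => F (c • (x - a))) 2 volume := by
  have hm : Continuous fun x => F (c • (x - a)) := hFc.comp (by fun_prop)
  rw [memLp_two_iff_integrable_sq hm.aestronglyMeasurable]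
  have h := (memLp_two_iff_integrable_sq hF.1).1 hF
  exact (h.comp_smul hc).comp_sub_right a

theorem memLp_truncYukawa {μ : ℝ} (hμ : 0 < μ) : MemLp (truncYukawa μ) 2 volume :=
  memLp_of_exp_decay (contDiff_truncYukawa μ).continuous hμ fun _ hz => abs_truncYukawa_le hz

theorem memLp_pd_truncYukawa {μ : ℝ} (hμ : 0 < μ) (e : E3) :
    MemLp (pd e (truncYukawa μ)) 2 volume :=
  memLp_of_exp_decay ((contDiff_truncYukawa μ).pd e).continuous hμ
    fun _ hz => abs_pd_truncYukawa_le' hμ hz e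

theorem memLp_lap_truncYukawa {μ : ℝ} (hμ : 0 < μ) : MemLp (lap (truncYukawa μ)) 2 volume :=
  memLp_of_exp_decay (contDiff_truncYukawa μ).lap.continuous hμ
    fun _ hz => abs_lap_truncYukawa_le hz

section Scaled

variable {τ ε : ℝ}

theorem memLp_scaled_truncYukawa (hτ : 0 < τ) (hε : 0 < ε) (a : E3) :
    MemLp (fun x => truncYukawa (ε * τ) (ε⁻¹ • (x - a))) 2 volume :=
  memLp_comp_smul_sub (memLp_truncYukawa (mul_pos hε hτ)) (contDiff_truncYukawa _).continuous a
    (inv_ne_zero hε.ne')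

theorem memLp_pd_scaled_truncYukawa (hτ : 0 < τ) (hε : 0 < ε) (a e : E3) :
    MemLp (pd e (fun x => truncYukawa (ε * τ) (ε⁻¹ • (x - a)))) 2 volume := by
  rw [pd_comp_smul_sub (contDiff_truncYukawa _)]
  exact (memLp_comp_smul_sub (memLp_pd_truncYukawa (mul_pos hε hτ) e)
    ((contDiff_truncYukawa _).pd e).continuous a (inv_ne_zero hε.ne')).const_mul _

theorem memLp_lap_scaled_truncYukawa (hτ : 0 < τ) (hε : 0 < ε) (a : E3) :
    MemLp (lap (fun x => truncYukawa (ε * τ) (ε⁻¹ • (x - a)))) 2 volume := by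
  rw [lap_comp_smul_sub (contDiff_truncYukawa _)]
  exact (memLp_comp_smul_sub (memLp_lap_truncYukawa (mul_pos hε hτ))
    (contDiff_truncYukawa _).lap.continuous a (inv_ne_zero hε.ne')).const_mul _

theorem helmholtz_scaled_truncYukawa (hε : 0 < ε) (a x : E3) :
    τ ^ 2 * truncYukawa (ε * τ) (ε⁻¹ • (x - a))
      - lap (fun x => truncYukawa (ε * τ) (ε⁻¹ • (x - a))) x
      = (ε ^ 2)⁻¹ * yukawaSource (ε * τ) (ε⁻¹ • (x - a)) := by
  rw [lap_comp_smul_sub (contDiff_truncYukawa _), yukawaSource]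
  field_simp

theorem IsWeakSolution.integral_mul_source {f v : E3 → ℝ} {G : E3 → E3}
    (h : IsWeakSolution τ f v G) (hf : MemLp f 2 volume) (hτ : 0 < τ) (hε : 0 < ε) (a : E3) :
    ∫ x, v x * yukawaSource (ε * τ) (ε⁻¹ • (x - a))
      = ε ^ 2 * ∫ x, f x * truncYukawa (ε * τ) (ε⁻¹ • (x - a)) := by
  have h1 := h.integral_mul_helmholtz_of_memLp hf
    (contDiff_comp_smul_sub (contDiff_truncYukawa (ε * τ)) a ε⁻¹)
    (memLp_scaled_truncYukawa hτ hε a) (memLp_pd_scaled_truncYukawa hτ hε a)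
    (memLp_lap_scaled_truncYukawa hτ hε a)
  simp only [helmholtz_scaled_truncYukawa hε] at h1
  simp only [mul_left_comm _ ((ε ^ 2)⁻¹) _, integral_const_mul] at h1
  rw [← h1]
  field_simp

theorem IsWeakSolution.integral_grad_mul_source {f v : E3 → ℝ} {G : E3 → E3}
    (h : IsWeakSolution τ f v G) (hf : MemLp f 2 volume) (hτ : 0 < τ) (hε : 0 < ε) (a e : E3) :
    ∫ x, inner ℝ (G x) e * yukawaSource (ε * τ) (ε⁻¹ • (x - a))
      = -(ε * ∫ x, f x * pd e (truncYukawa (ε * τ)) (ε⁻¹ • (x - a))) := by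
  have h1 := h.integral_grad_mul_helmholtz_of_memLp hf
    (contDiff_comp_smul_sub (contDiff_truncYukawa (ε * τ)) a ε⁻¹)
    (memLp_scaled_truncYukawa hτ hε a) (memLp_pd_scaled_truncYukawa hτ hε a)
    (memLp_lap_scaled_truncYukawa hτ hε a) e
  simp only [helmholtz_scaled_truncYukawa hε, pd_comp_smul_sub (contDiff_truncYukawa _)] at h1
  simp only [mul_left_comm _ ((ε ^ 2)⁻¹) _, mul_left_comm _ (ε⁻¹) _, integral_const_mul] at h1
  have key : ∀ X Y : ℝ, (ε ^ 2)⁻¹ * X = -(ε⁻¹ * Y) → X = -(ε * Y) := by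
    intro X Y hXY
    field_simp at hXY
    linarith
  exact key _ _ h1

end Scaled

theorem norm_inv_smul {ε : ℝ} (hε : 0 < ε) (y : E3) : ‖ε⁻¹ • y‖ = ‖y‖ / ε := by
  rw [norm_smul, norm_inv, Real.norm_eq_abs, abs_of_pos hε, inv_mul_eq_div]

theorem scaled_source_eq_zero {ε : ℝ} (hε : 0 < ε) (μ : ℝ) {a x : E3}
    (hx : x ∉ Metric.closedBall a ε) : yukawaSource μ (ε⁻¹ • (x - a)) = 0 := by
  rw [mem_closedBall_iff_norm, not_le] at hx
  apply yukawaSource_of_gt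
  rw [norm_inv_smul hε, lt_div_iff₀ hε]
  linarith

theorem hasCompactSupport_scaled_source {ε : ℝ} (hε : 0 < ε) (μ : ℝ) (a : E3) :
    HasCompactSupport (fun x => yukawaSource μ (ε⁻¹ • (x - a))) :=
  HasCompactSupport.intro (isCompact_closedBall a ε) fun _ hx => scaled_source_eq_zero hε μ hx

theorem contDiff_scaled_source (ε μ : ℝ) (a : E3) :
    ContDiff ℝ ∞ (fun x => yukawaSource μ (ε⁻¹ • (x - a))) :=
  contDiff_comp_smul_sub (contDiff_yukawaSource μ) a ε⁻¹

theorem truncYukawa_scaled_of_ge {ε : ℝ} (hε : 0 < ε) (τ : ℝ) {a x : E3} (hx : ε ≤ ‖x - a‖) :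
    truncYukawa (ε * τ) (ε⁻¹ • (x - a)) = ε * Real.exp (-(τ * ‖x - a‖)) / ‖x - a‖ := by
  have h1 : 1 ≤ ‖ε⁻¹ • (x - a)‖ := by
    rw [norm_inv_smul hε, le_div_iff₀ hε]
    linarith
  rw [truncYukawa_of_ge _ h1, norm_inv_smul hε]
  have h2 : ε * τ * (‖x - a‖ / ε) = τ * ‖x - a‖ := by field_simp
  rw [h2, div_div_eq_mul_div, mul_comm]

theorem sq_setIntegral_le {g : E3 → ℝ} {a : E3} {r : ℝ} (hr : 0 < r) (hg : MemLp g 2 volume) :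
    (∫ x in Metric.closedBall a r, g x) ^ 2
      ≤ (volume : Measure E3).real (Metric.closedBall a r)
        * ∫ x in Metric.closedBall a r, g x ^ 2 := by
  set s := Metric.closedBall a r
  set m := (volume : Measure E3).real s with hm
  have hm0 : 0 < m := ENNReal.toReal_pos (Metric.measure_closedBall_pos _ _ hr).ne'
    measure_closedBall_lt_top.ne
  have hfin : IsFiniteMeasure (volume.restrict s : Measure E3) :=
    isFiniteMeasure_restrict.2 measure_closedBall_lt_top.ne
  have hgs : MemLp g 2 (volume.restrict s) := hg.restrict s
  have hg1 : Integrable g (volume.restrict s) := hgs.integrable (by norm_num)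
  have hg2 : Integrable (fun x => g x ^ 2) (volume.restrict s) := hgs.integrable_sq
  set A := ∫ x in s, g x
  have h0 : 0 ≤ ∫ x in s, (g x - A / m) ^ 2 := integral_nonneg fun x => sq_nonneg _
  have h1 : ∫ x in s, (g x - A / m) ^ 2
      = (∫ x in s, g x ^ 2) - 2 * (A / m) * A + m * (A / m) ^ 2 := by
    have : ∀ x, (g x - A / m) ^ 2 = g x ^ 2 - 2 * (A / m) * g x + (A / m) ^ 2 := by
      intro x; ring
    simp only [this]
    have e1 := integral_add (hg2.sub (hg1.const_mul (2 * (A / m))))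
      (integrable_const ((A / m) ^ 2))
    have e2 := integral_sub hg2 (hg1.const_mul (2 * (A / m)))
    simp only [Pi.sub_apply] at e1
    rw [e1, e2, integral_const_mul, setIntegral_const, smul_eq_mul]
  rw [h1] at h0
  have h2 : (∫ x in s, g x ^ 2) - 2 * (A / m) * A + m * (A / m) ^ 2
      = (∫ x in s, g x ^ 2) - A ^ 2 / m := by
    field_simp
    ring
  rw [h2, sub_nonneg, div_le_iff₀ hm0] at h0
  linarith

theorem exists_bound_gradient_source (μ : ℝ) :
    ∃ N : ℝ, 0 < N ∧ ∀ e z, |pd e (yukawaSource μ) z| ≤ N * ‖e‖ := by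
  have hc := contDiff_yukawaSource μ
  obtain ⟨N, hN⟩ := ((hasCompactSupport_yukawaSource μ).fderiv
    (𝕜 := ℝ)).exists_bound_of_continuous (hc.continuous_fderiv (by simp))
  refine ⟨|N| + 1, by positivity, fun e z => ?_⟩
  refine ((fderiv ℝ (yukawaSource μ) z).le_opNorm e).trans ?_
  gcongr
  exact (hN z).trans (by linarith [le_abs_self N])

theorem lower_integral_of_le {B : Set E3} {f φ : E3 → ℝ} {c m : ℝ} (hf : MemLp f 2 volume)
    (hsupp : ∀ᵐ x : E3, x ∉ closure B → f x = 0) (hnull : volume (frontier B) = 0)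
    (hB : IsOpen B) (hc : 0 < c) (hfB : ∀ᵐ x : E3, x ∈ B → c ≤ f x) (hφ : MemLp φ 2 volume)
    (hφ0 : ∀ x, 0 ≤ φ x) {a : E3} {r : ℝ} (hr : 0 ≤ r) (hsub : Metric.closedBall a r ⊆ B)
    (hm : ∀ x ∈ Metric.closedBall a r, m ≤ φ x) :
    c * m * (r ^ 3 * (volume : Measure E3).real (Metric.ball 0 1)) ≤ ∫ x, f x * φ x := by
  have hinteg := integrable_mul_of_memLp_two hf hφ
  have hnn : 0 ≤ᵐ[volume] fun x => f x * φ x := by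
    filter_upwards [hsupp, hfB, measure_eq_zero_iff_ae_notMem.1 hnull] with x h1 h2 h3
    by_cases hx : x ∈ B
    · exact mul_nonneg (hc.le.trans (h2 hx)) (hφ0 x)
    · have hxc : x ∉ closure B := fun hxc => h3 (hB.frontier_eq ▸ ⟨hxc, hx⟩)
      simp [h1 hxc]
  refine le_trans (const_mul_le_setIntegral_closedBall (a := a) hinteg hr ?_)
    (setIntegral_le_integral hinteg hnn)
  filter_upwards [hfB] with x hx hxa
  exact mul_le_mul_of_nonneg (hx (hsub hxa)) (hm x hxa) hc.le (hφ0 x)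

theorem EmissionCondition.exists_lower_integral {B : Set E3} {f : E3 → ℝ}
    (hf : EmissionCondition B f) (hB : IsOpen B) (hnull : volume (frontier B) = 0) :
    ∃ c : ℝ, 0 < c ∧ ∀ (φ : E3 → ℝ) (a : E3) (r m : ℝ), MemLp φ 2 volume → (∀ x, 0 ≤ φ x) →
      0 ≤ r → Metric.closedBall a r ⊆ B → (∀ x ∈ Metric.closedBall a r, m ≤ φ x) →
      c * m * (r ^ 3 * (volume : Measure E3).real (Metric.ball 0 1)) ≤ |∫ x, f x * φ x| := by
  obtain ⟨hfL, hsupp, c, hc, h | h⟩ := hf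
  · exact ⟨c, hc, fun φ a r m hφ hφ0 hr hsub hm => (lower_integral_of_le hfL hsupp hnull hB hc h hφ
      hφ0 hr hsub hm).trans (le_abs_self _)⟩
  · refine ⟨c, hc, fun φ a r m hφ hφ0 hr hsub hm => ?_⟩
    have := lower_integral_of_le hfL.neg (by simpa using hsupp) hnull hB hc h hφ hφ0 hr hsub hm
    refine this.trans ?_
    rw [← abs_neg, ← integral_neg]
    refine le_trans (le_of_eq ?_) (le_abs_self _)
    simp

theorem IsWeakSolution.sq_integral_le {τ ε N : ℝ} {f v : E3 → ℝ} {G : E3 → E3} {D B : Set E3}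
    (h : IsWeakSolution τ f v G) (hf : MemLp f 2 volume)
    (hsupp : ∀ᵐ x : E3, x ∉ closure B → f x = 0) (hDB : Disjoint (closure B) (closure D))
    (hτ : 0 < τ) (hε : 0 < ε) {a : E3} (ha : Metric.closedBall a ε ⊆ D) (hN0 : 0 < N)
    (hN : ∀ e z, |pd e (yukawaSource (ε * τ)) z| ≤ N * ‖e‖) :
    ((ε * τ) ^ 2 * ∫ x, f x * truncYukawa (ε * τ) (ε⁻¹ • (x - a))) ^ 2
      ≤ N ^ 2 * (volume : Measure E3).real (Metric.ball 0 1) * ε * ∫ x in D, ‖G x‖ ^ 2 := by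
  set μ := ε * τ with hμ
  set ψ : E3 → ℝ := fun x => yukawaSource μ (ε⁻¹ • (x - a)) with hψ
  have hψs : ContDiff ℝ ∞ ψ := contDiff_scaled_source ε μ a
  have hψc : HasCompactSupport ψ := hasCompactSupport_scaled_source hε μ a
  have heq := h.equation ψ hψs hψc
  have hzero : ∫ x, f x * ψ x = 0 := by
    refine integral_eq_zero_of_ae ?_
    filter_upwards [hsupp] with x hx
    by_cases hxB : x ∈ closure B
    · have hxa : x ∉ Metric.closedBall a ε := fun hxa =>
        Set.disjoint_left.1 hDB hxB (subset_closure (ha hxa))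
      simp [hψ, scaled_source_eq_zero hε μ hxa]
    · simp [hx hxB]
  rw [hzero, h.integral_mul_source hf hτ hε a] at heq
  have hkey : (μ ^ 2 * ∫ x, f x * truncYukawa μ (ε⁻¹ • (x - a))) ^ 2
      = (∫ x, inner ℝ (G x) (gradient ψ x)) ^ 2 := by
    have : ∫ x, inner ℝ (G x) (gradient ψ x)
        = -(μ ^ 2 * ∫ x, f x * truncYukawa μ (ε⁻¹ • (x - a))) := by
      rw [hμ]
      linarith
    rw [this, neg_sq]
  rw [hkey]
  set s := Metric.closedBall a ε
  have hGn : MemLp (fun x => ‖G x‖) 2 volume := h.memLp_grad.norm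
  have hpt : ∀ x, ‖inner ℝ (G x) (gradient ψ x)‖ ≤ s.indicator (fun x => ε⁻¹ * N * ‖G x‖) x := by
    intro x
    rw [inner_gradient_eq_pd]
    by_cases hx : x ∈ s
    · rw [Set.indicator_of_mem hx, hψ, pd_comp_smul_sub (contDiff_yukawaSource μ), norm_mul,
        norm_inv, Real.norm_eq_abs, Real.norm_eq_abs, abs_of_pos hε, mul_assoc]
      gcongr
      exact hN _ _
    · have hts : x ∉ tsupport ψ := fun hxt => hx
        (closure_minimal (s := Function.support ψ) (fun y hy => by_contra fun hys => hy (scaled_source_eq_zero hε μ hys))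
          Metric.isClosed_closedBall hxt)
      have hzero' : fderiv ℝ ψ x = 0 := by
        by_contra hne
        exact hts (support_fderiv_subset ℝ hne)
      rw [Set.indicator_of_notMem hx]
      simp [pd, hzero']
  have hGs : Integrable (fun x => ‖G x‖) (volume.restrict s) := by
    have hfin : IsFiniteMeasure (volume.restrict s : Measure E3) :=
      isFiniteMeasure_restrict.2 measure_closedBall_lt_top.ne
    exact (hGn.restrict s).integrable (by norm_num)
  have hms : MeasurableSet s := Metric.isClosed_closedBall.measurableSet
  have h1 : |∫ x, inner ℝ (G x) (gradient ψ x)| ≤ ε⁻¹ * N * ∫ x in s, ‖G x‖ := by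
    rw [← integral_const_mul, ← integral_indicator hms]
    refine norm_integral_le_of_norm_le ?_ (Eventually.of_forall hpt)
    exact (integrable_indicator_iff hms).2 (hGs.const_mul _)
  have h2 := sq_setIntegral_le (a := a) hε hGn
  have hsq : Integrable (fun x => ‖G x‖ ^ 2) volume := hGn.integrable_sq
  have h3 : ∫ x in s, ‖G x‖ ^ 2 ≤ ∫ x in D, ‖G x‖ ^ 2 :=
    setIntegral_mono_set hsq.integrableOn (Eventually.of_forall fun x => sq_nonneg _)
      (LE.le.eventuallyLE ha)
  rw [volume_real_closedBall a hε.le] at h2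
  set V := (volume : Measure E3).real (Metric.ball 0 1)
  calc _ ≤ (ε⁻¹ * N * ∫ x in s, ‖G x‖) ^ 2 := by
        rw [← sq_abs]
        exact pow_le_pow_left₀ (abs_nonneg _) h1 2
    _ = (ε⁻¹ * N) ^ 2 * (∫ x in s, ‖G x‖) ^ 2 := by ring
    _ ≤ (ε⁻¹ * N) ^ 2 * (ε ^ 3 * V * ∫ x in s, ‖G x‖ ^ 2) := by gcongr
    _ ≤ (ε⁻¹ * N) ^ 2 * (ε ^ 3 * V * ∫ x in D, ‖G x‖ ^ 2) := by gcongr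
    _ = _ := by field_simp

theorem exists_lower_bound {D B : Set E3} {f : E3 → ℝ} (hf : EmissionCondition B f)
    (hB : IsOpen B) (hnull : volume (frontier B) = 0) (hDB : Disjoint (closure B) (closure D))
    {p q : E3} (hpq : ‖p - q‖ = setDist D B) (hp : HasInnerBalls D p) (hq : HasInnerBalls B q) :
    ∃ c : ℝ, 0 < c ∧ ∀ τ : ℝ, 1 ≤ τ → ∀ (v : E3 → ℝ) (G : E3 → E3), IsWeakSolution τ f v G →
      c * τ ^ (-7 : ℤ) * Real.exp (-2 * τ * setDist D B) ≤ ∫ x in D, ‖G x‖ ^ 2 := by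
  obtain ⟨c, hc, hlow⟩ := hf.exists_lower_integral hB hnull
  obtain ⟨n, h, ρ, hn, hh, hρ0, hρ1, hballs⟩ := hp
  obtain ⟨n', h', ρ', hn', hh', hρ0', hρ1', hballs'⟩ := hq
  obtain ⟨N, hN0, hN⟩ := exists_bound_gradient_source (h * ρ)
  set d := setDist D B
  set V := (volume : Measure E3).real (Metric.ball 0 1)
  have hV : 0 < V := volume_real_unitBall_pos
  have hd : 0 ≤ d := hpq ▸ norm_nonneg _
  set M := h + 2 * h' with hM
  have hM0 : 0 < M := by positivity
  set A := c * (h * ρ * Real.exp (-M) / (d + M)) * ((h' * ρ') ^ 3 * V) with hA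
  have hA0 : 0 < A := by positivity
  refine ⟨(h * ρ) ^ 3 * A ^ 2 / (N ^ 2 * V), by positivity, fun τ hτ v G hsol => ?_⟩
  have hτ0 : 0 < τ := by linarith
  set a := p + (h / τ) • n
  set ε := h / τ * ρ with hε
  have hε0 : 0 < ε := by positivity
  have hετ : ε * τ = h * ρ := by rw [hε]; field_simp
  have hht : h / τ ≤ h := div_le_self hh.le hτ
  have hht' : h' / τ ≤ h' := div_le_self hh'.le hτ
  have haD : Metric.closedBall a ε ⊆ D := hballs (h / τ) (by positivity) hht
  have hQB : Metric.closedBall (q + (h' / τ) • n') (h' / τ * ρ') ⊆ B :=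
    hballs' (h' / τ) (by positivity) hht'
  have hsq := hsol.sq_integral_le hf.1 hf.2.1 hDB hτ0 hε0 haD hN0 (by rw [hετ]; exact hN)
  have hφ : ∀ y ∈ Metric.closedBall (q + (h' / τ) • n') (h' / τ * ρ'),
      ε * (Real.exp (-M) * Real.exp (-(τ * d))) / (d + M)
        ≤ truncYukawa (ε * τ) (ε⁻¹ • (y - a)) := by
    intro y hy
    have hyD : y ∉ Metric.closedBall a ε := fun hya =>
      Set.disjoint_left.1 hDB (subset_closure (hQB hy)) (subset_closure (haD hya))
    rw [mem_closedBall_iff_norm, not_le] at hyD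
    rw [truncYukawa_scaled_of_ge hε0 τ hyD.le]
    have hr : ‖y - a‖ ≤ d + M / τ := by
      rw [mem_closedBall_iff_norm] at hy
      have e1 : y - a = (y - (q + (h' / τ) • n')) + (h' / τ) • n' - (p - q) - (h / τ) • n := by
        simp only [a]
        abel
      have e2 : ‖(h' / τ) • n'‖ ≤ h' / τ := by
        rw [norm_smul, Real.norm_eq_abs, abs_of_pos (by positivity)]
        exact mul_le_of_le_one_right (by positivity) hn'
      have e3 : ‖(h / τ) • n‖ ≤ h / τ := by
        rw [norm_smul, Real.norm_eq_abs, abs_of_pos (by positivity)]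
        exact mul_le_of_le_one_right (by positivity) hn
      have e4 : h' / τ * ρ' ≤ h' / τ := mul_le_of_le_one_right (by positivity) hρ1'
      rw [e1]
      refine (norm_sub_le _ _).trans ?_
      have e5 := norm_sub_le ((y - (q + (h' / τ) • n')) + (h' / τ) • n') (p - q)
      have e6 := norm_add_le (y - (q + (h' / τ) • n')) ((h' / τ) • n')
      have e7 : M / τ = h / τ + 2 * (h' / τ) := by rw [hM]; ring
      linarith
    have hMτ : M / τ ≤ M := div_le_self hM0.le hτ
    have hr' : ‖y - a‖ ≤ d + M := hr.trans (by linarith)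
    have hexp : Real.exp (-M) * Real.exp (-(τ * d)) ≤ Real.exp (-(τ * ‖y - a‖)) := by
      rw [← Real.exp_add]
      apply Real.exp_le_exp.2
      have : τ * ‖y - a‖ ≤ τ * (d + M / τ) := by gcongr
      have h2 : τ * (d + M / τ) = τ * d + M := by field_simp
      linarith
    have hpos : 0 < ‖y - a‖ := hε0.trans hyD
    gcongr
  have hI := hlow _ _ _ _ (memLp_scaled_truncYukawa hτ0 hε0 a) (fun x => truncYukawa_nonneg _ _)
    (by positivity : 0 ≤ h' / τ * ρ') hQB hφ
  set I := ∫ x, f x * truncYukawa (ε * τ) (ε⁻¹ • (x - a))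
  have hAI : A / τ ^ 4 * Real.exp (-(τ * d)) ≤ |I| := by
    refine le_trans (le_of_eq ?_) hI
    rw [hA, hε]
    field_simp
  have hAI2 : (A / τ ^ 4 * Real.exp (-(τ * d))) ^ 2 ≤ I ^ 2 := by
    rw [← sq_abs I]
    exact pow_le_pow_left₀ (by positivity) hAI 2
  rw [mul_pow, hετ] at hsq
  have hfin : ((h * ρ) ^ 2) ^ 2 * (A / τ ^ 4 * Real.exp (-(τ * d))) ^ 2
      ≤ N ^ 2 * V * ε * ∫ x in D, ‖G x‖ ^ 2 :=
    (mul_le_mul_of_nonneg_left hAI2 (by positivity)).trans hsq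
  have hee : Real.exp (-2 * τ * d) = Real.exp (-(τ * d)) ^ 2 := by
    rw [← Real.exp_nat_mul]
    congr 1
    push_cast
    ring
  rw [hee]
  refine le_of_mul_le_mul_left (le_trans (le_of_eq ?_) hfin) (by positivity : 0 < N ^ 2 * V * ε)
  have hz : τ ^ (-7 : ℤ) = (τ ^ 7)⁻¹ := by
    rw [zpow_neg]
    norm_cast
  rw [hz, hε]
  field_simp

theorem integral_scaled_source {ε : ℝ} (hε : 0 < ε) (μ : ℝ) (a : E3) :
    ∫ x, yukawaSource μ (ε⁻¹ • (x - a)) = ε ^ 3 * ∫ z, yukawaSource μ z := by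
  rw [integral_sub_right_eq_self (fun x => yukawaSource μ (ε⁻¹ • x)) a,
    Measure.integral_comp_inv_smul_of_nonneg _ _ hε.le]
  simp

theorem integrable_abs_mul_exp {f : E3 → ℝ} (hf : MemLp f 2 volume) (a : E3) :
    Integrable (fun x => |f x| * Real.exp (-‖x - a‖)) volume ∧
    ∫ x, |f x| * Real.exp (-‖x - a‖)
      ≤ (∫ x, f x ^ 2) + ∫ x : E3, Real.exp (-‖x‖) ^ 2 := by
  have hE : MemLp (fun x : E3 => Real.exp (-‖x‖)) 2 volume := by
    simpa using memLp_exp_neg_mul_norm one_pos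
  have hEi := hE.integrable_sq
  have hEa := hEi.comp_sub_right a
  have hEm : MemLp (fun x : E3 => Real.exp (-‖x - a‖)) 2 volume := by
    rw [memLp_two_iff_integrable_sq (by fun_prop)]
    exact hEa
  have hinteg := integrable_mul_of_memLp_two hf.abs hEm
  refine ⟨hinteg, ?_⟩
  rw [← integral_sub_right_eq_self (fun x : E3 => Real.exp (-‖x‖) ^ 2) a,
    ← integral_add hf.integrable_sq hEa]
  refine integral_mono hinteg (hf.integrable_sq.add hEa) fun x => ?_
  simp only
  nlinarith [sq_nonneg (|f x| - Real.exp (-‖x - a‖)), sq_abs (f x), sq_nonneg (f x),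
    sq_nonneg (Real.exp (-‖x - a‖))]

theorem abs_integral_mul_pd_le {f : E3 → ℝ} (hf : MemLp f 2 volume) {S : Set E3}
    (hsupp : ∀ᵐ x : E3, x ∉ S → f x = 0) {a : E3} {d τ ε : ℝ} (hd : 0 < d) (hτ : 1 ≤ τ)
    (hε : 0 < ε) (hεd : ε < d) (ha : ∀ x ∈ S, d ≤ ‖x - a‖) (e : E3) :
    |∫ x, f x * pd e (truncYukawa (ε * τ)) (ε⁻¹ • (x - a))|
      ≤ ε ^ 2 * τ * Real.exp (-(τ * d)) * ((1 / d + 1 / d ^ 2) * Real.exp d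
        * ((∫ x, f x ^ 2) + ∫ x : E3, Real.exp (-‖x‖) ^ 2)) * ‖e‖ := by
  have hτ0 : 0 < τ := by linarith
  set K := ε ^ 2 * τ * Real.exp (-(τ * d)) * ((1 / d + 1 / d ^ 2) * Real.exp d) * ‖e‖ with hK
  obtain ⟨hi, hle⟩ := integrable_abs_mul_exp hf a
  have hpt : ∀ᵐ x : E3, ‖f x * pd e (truncYukawa (ε * τ)) (ε⁻¹ • (x - a))‖
      ≤ K * (|f x| * Real.exp (-‖x - a‖)) := by
    filter_upwards [hsupp] with x hx
    by_cases hxS : x ∈ S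
    · have hr := ha x hxS
      set r := ‖x - a‖
      have hr0 : 0 < r := by linarith
      have hz : ‖ε⁻¹ • (x - a)‖ = r / ε := norm_inv_smul hε _
      have hz1 : 1 < ‖ε⁻¹ • (x - a)‖ := by
        rw [hz, lt_div_iff₀ hε]
        linarith
      have hb := abs_pd_truncYukawa_le (mul_pos hε hτ0) hz1 e
      rw [hz] at hb
      have e1 : ε * τ * (r / ε) = τ * r := by field_simp
      have e2 : ε * τ / (r / ε) + 1 / (r / ε) ^ 2 = ε ^ 2 * (τ / r + 1 / r ^ 2) := by field_simp
      rw [e1, e2] at hb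
      have e3 : τ / r + 1 / r ^ 2 ≤ τ * (1 / d + 1 / d ^ 2) := by
        have t1 : τ / r ≤ τ / d := by gcongr
        have t2 : 1 / r ^ 2 ≤ 1 / d ^ 2 := by gcongr
        have t3 : 1 / d ^ 2 ≤ τ * (1 / d ^ 2) := le_mul_of_one_le_left (by positivity) hτ
        have t4 : τ * (1 / d + 1 / d ^ 2) = τ / d + τ * (1 / d ^ 2) := by ring
        linarith
      have e4 : Real.exp (-(τ * r)) ≤ Real.exp (-(τ * d)) * (Real.exp d * Real.exp (-r)) := by
        rw [← Real.exp_add, ← Real.exp_add]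
        apply Real.exp_le_exp.2
        nlinarith
      rw [norm_mul, Real.norm_eq_abs, Real.norm_eq_abs]
      calc |f x| * |pd e (truncYukawa (ε * τ)) (ε⁻¹ • (x - a))|
          ≤ |f x| * (Real.exp (-(τ * d)) * (Real.exp d * Real.exp (-r))
            * (ε ^ 2 * (τ * (1 / d + 1 / d ^ 2))) * ‖e‖) := by
            gcongr
            refine hb.trans ?_
            gcongr
        _ = K * (|f x| * Real.exp (-r)) := by rw [hK]; ring
    · rw [hx hxS]
      simp
  have h1 := norm_integral_le_of_norm_le (hi.const_mul K) hpt
  rw [Real.norm_eq_abs, integral_const_mul] at h1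
  refine h1.trans ?_
  calc K * ∫ x, |f x| * Real.exp (-‖x - a‖)
      ≤ K * ((∫ x, f x ^ 2) + ∫ x : E3, Real.exp (-‖x‖) ^ 2) := by gcongr
    _ = _ := by rw [hK]; ring

theorem IsWeakSolution.inner_le_of_average {τ ε κ C d : ℝ} {f v : E3 → ℝ} {G : E3 → E3}
    {S : Set E3} (h : IsWeakSolution τ f v G) (hf : MemLp f 2 volume)
    (hsupp : ∀ᵐ x : E3, x ∉ S → f x = 0) (hd : 0 < d) (hτ : 1 ≤ τ) (hε : 0 < ε) (hεd : ε < d)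
    {a : E3} (ha : ∀ x ∈ S, d ≤ ‖x - a‖)
    (hC : ∀ z, |yukawaSource (ε * τ) z| ≤ C) (hκ : κ ≤ ∫ z, yukawaSource (ε * τ) z) :
    κ * ‖G a‖ ^ 2 ≤ (τ * Real.exp (-(τ * d)) * ((1 / d + 1 / d ^ 2) * Real.exp d
        * ((∫ x, f x ^ 2) + ∫ x : E3, Real.exp (-‖x‖) ^ 2))
        + C * (volume : Measure E3).real (Metric.ball 0 1)
          * ⨍ y in Metric.closedBall a ε, ‖G y - G a‖) * ‖G a‖ := by
  have hτ0 : 0 < τ := by linarith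
  set V := (volume : Measure E3).real (Metric.ball 0 1)
  have hV : 0 < V := volume_real_unitBall_pos
  set ψ : E3 → ℝ := fun x => yukawaSource (ε * τ) (ε⁻¹ • (x - a)) with hψ
  set e := G a with he
  set s := Metric.closedBall a ε with hs
  have hC0 : 0 ≤ C := (abs_nonneg _).trans (hC 0)
  have hms : MeasurableSet s := Metric.isClosed_closedBall.measurableSet
  have hψc : ContDiff ℝ ∞ ψ := contDiff_scaled_source ε _ a
  have hψsupp : HasCompactSupport ψ := hasCompactSupport_scaled_source hε _ a
  have hψi : Integrable ψ volume := hψc.continuous.integrable_of_hasCompactSupport hψsupp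
  have hfin : IsFiniteMeasure (volume.restrict s : Measure E3) :=
    isFiniteMeasure_restrict.2 measure_closedBall_lt_top.ne
  have hGs : Integrable (fun x => ‖G x - e‖) (volume.restrict s) :=
    (((h.memLp_grad.restrict s).integrable (by norm_num)).sub (integrable_const e)).norm
  have hb := abs_integral_mul_pd_le hf hsupp hd hτ hε hεd ha e
  have hid := h.integral_grad_mul_source hf hτ0 hε a e
  have hGψ : Integrable (fun x => inner ℝ (G x) e * ψ x) volume :=
    integrable_mul_of_memLp_two (h.memLp_grad.inner_const_real e) (memLp_two_of_test hψc hψsupp)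
  have hsplit : ∫ x, inner ℝ (G x - e) e * ψ x
      = (∫ x, inner ℝ (G x) e * ψ x) - ‖e‖ ^ 2 * ∫ x, ψ x := by
    rw [← integral_const_mul, ← integral_sub hGψ (hψi.const_mul _)]
    refine integral_congr_ae (Eventually.of_forall fun x => ?_)
    simp only [inner_sub_left, real_inner_self_eq_norm_sq]
    ring
  have hpt : ∀ x, ‖inner ℝ (G x - e) e * ψ x‖ ≤ s.indicator (fun x => ‖e‖ * C * ‖G x - e‖) x := by
    intro x
    by_cases hx : x ∈ s
    · rw [Set.indicator_of_mem hx, norm_mul, Real.norm_eq_abs, Real.norm_eq_abs]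
      calc |inner ℝ (G x - e) e| * |ψ x| ≤ (‖G x - e‖ * ‖e‖) * C := by
            gcongr
            · exact abs_real_inner_le_norm _ _
            · exact hC _
        _ = ‖e‖ * C * ‖G x - e‖ := by ring
    · rw [Set.indicator_of_notMem hx, hψ]
      simp [scaled_source_eq_zero hε _ hx]
  have herr : |∫ x, inner ℝ (G x - e) e * ψ x| ≤ ‖e‖ * C * ∫ x in s, ‖G x - e‖ := by
    rw [← integral_const_mul, ← integral_indicator hms]
    refine norm_integral_le_of_norm_le ?_ (Eventually.of_forall hpt)
    exact (integrable_indicator_iff hms).2 (hGs.const_mul _)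
  have havg : ∫ x in s, ‖G x - e‖ = ε ^ 3 * V * ⨍ y in s, ‖G y - e‖ := by
    rw [setAverage_eq, hs, volume_real_closedBall a hε.le, smul_eq_mul]
    exact (mul_inv_cancel_left₀ (by positivity : ε ^ 3 * V ≠ 0) _).symm
  rw [integral_scaled_source hε] at hsplit
  rw [hsplit, hid] at herr
  rw [havg] at herr
  set P := ⨍ y in s, ‖G y - e‖
  set J := ∫ x, f x * pd e (truncYukawa (ε * τ)) (ε⁻¹ • (x - a))
  set Z := ∫ z, yukawaSource (ε * τ) z
  set R := τ * Real.exp (-(τ * d)) * ((1 / d + 1 / d ^ 2) * Real.exp d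
        * ((∫ x, f x ^ 2) + ∫ x : E3, Real.exp (-‖x‖) ^ 2)) with hR
  have hJ : |J| ≤ ε ^ 2 * R * ‖e‖ := hb.trans (le_of_eq (by rw [hR]; ring))
  have hJ' := (abs_le.1 hJ).1
  have herr' := (abs_le.1 herr).1
  have hεJ := mul_le_mul_of_nonneg_left hJ' hε.le
  have hZ : ε ^ 3 * (‖e‖ ^ 2 * κ) ≤ ε ^ 3 * (‖e‖ ^ 2 * Z) := by gcongr
  have hε3 : 0 < ε ^ 3 := by positivity
  refine le_of_mul_le_mul_left ?_ hε3
  linarith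

theorem exists_upper_pointwise {D B : Set E3} {f : E3 → ℝ} (hf : EmissionCondition B f)
    (hd : 0 < setDist D B) :
    ∃ M : ℝ, 0 < M ∧ ∀ τ : ℝ, 1 ≤ τ → ∀ (v : E3 → ℝ) (G : E3 → E3), IsWeakSolution τ f v G →
      ∀ᵐ a : E3, a ∈ closure D → ‖G a‖ ≤ M * τ * Real.exp (-(τ * setDist D B)) := by
  obtain ⟨C, hC0, hC⟩ := exists_bound_yukawaSource
  obtain ⟨κ, hκ0, hκ⟩ := exists_integral_yukawaSource_ge
  set d := setDist D B with hddef
  set F := (1 / d + 1 / d ^ 2) * Real.exp d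
    * ((∫ x, f x ^ 2) + ∫ x : E3, Real.exp (-‖x‖) ^ 2) with hF
  have hF0 : 0 ≤ F := by
    have h1 : 0 ≤ ∫ x, f x ^ 2 := integral_nonneg fun x => sq_nonneg _
    have h2 : 0 ≤ ∫ x : E3, Real.exp (-‖x‖) ^ 2 := integral_nonneg fun x => sq_nonneg _
    positivity
  refine ⟨F / κ + 1, by positivity, fun τ hτ v G h => ?_⟩
  have hτ0 : 0 < τ := by linarith
  have hloc : LocallyIntegrable G volume := h.memLp_grad.locallyIntegrable (by norm_num)
  filter_upwards [IsUnifLocDoublingMeasure.ae_tendsto_average_norm_sub volume hloc 1] with a ha haD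
  have hlim : Tendsto (fun ε : ℝ => ⨍ y in Metric.closedBall a ε, ‖G y - G a‖) (𝓝[>] 0) (𝓝 0) :=
    ha (fun _ => a) (fun ε => ε) tendsto_id (by
      filter_upwards [self_mem_nhdsWithin] with ε hε
      exact Metric.mem_closedBall_self (by rw [one_mul]; exact le_of_lt hε))
  have hdist : ∀ x ∈ closure B, d ≤ ‖x - a‖ := fun x hx => by
    rw [norm_sub_rev]
    exact setDist_le haD hx
  set V := (volume : Measure E3).real (Metric.ball 0 1)
  have hev : ∀ᶠ ε : ℝ in 𝓝[>] 0, κ * ‖G a‖ ^ 2 ≤ (τ * Real.exp (-(τ * d)) * F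
      + C * V * ⨍ y in Metric.closedBall a ε, ‖G y - G a‖) * ‖G a‖ := by
    have hmin : 0 < min d τ⁻¹ := lt_min hd (by positivity)
    filter_upwards [Ioo_mem_nhdsGT hmin] with ε hε
    have hε0 : 0 < ε := hε.1
    have hετ : ε * τ ≤ 1 := by
      have := (hε.2.trans_le (min_le_right _ _)).le
      rwa [← one_div, le_div_iff₀ hτ0] at this
    exact h.inner_le_of_average hf.1 hf.2.1 hd hτ hε0 (hε.2.trans_le (min_le_left _ _)) hdist
      (hC _ (mul_pos hε0 hτ0) hετ) (hκ _ (mul_pos hε0 hτ0) hετ)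
  have hlim2 := ((hlim.const_mul (C * V)).const_add (τ * Real.exp (-(τ * d)) * F)).mul_const ‖G a‖
  have hle := ge_of_tendsto hlim2 hev
  rw [mul_zero, add_zero] at hle
  have hE := Real.exp_pos (-(τ * d))
  rcases (norm_nonneg (G a)).eq_or_lt with h0 | h0
  · rw [← h0]
    positivity
  · have h1 : κ * ‖G a‖ ≤ τ * Real.exp (-(τ * d)) * F := by
      refine le_of_mul_le_mul_right ?_ h0
      linarith
    have h2 : ‖G a‖ ≤ (τ * Real.exp (-(τ * d)) * F) / κ := by
      rw [le_div_iff₀ hκ0]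
      linarith
    refine h2.trans ?_
    have h3 : 0 < τ * Real.exp (-(τ * d)) := by positivity
    have h4 : (F / κ + 1) * τ * Real.exp (-(τ * d))
        = τ * Real.exp (-(τ * d)) * F / κ + τ * Real.exp (-(τ * d)) := by ring
    linarith

theorem exists_upper_bound {D B : Set E3} {f : E3 → ℝ} (hf : EmissionCondition B f)
    (hD : Bornology.IsBounded D) (hd : 0 < setDist D B) :
    ∃ M : ℝ, 0 < M ∧ ∀ τ : ℝ, 1 ≤ τ → ∀ (v : E3 → ℝ) (G : E3 → E3), IsWeakSolution τ f v G →
      ∫ x in D, ‖G x‖ ^ 2 ≤ M * τ ^ 2 * Real.exp (-2 * τ * setDist D B) := by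
  obtain ⟨M, hM0, hM⟩ := exists_upper_pointwise hf hd
  set W := (volume : Measure E3).real (closure D)
  refine ⟨M ^ 2 * W + 1, by positivity, fun τ hτ v G h => ?_⟩
  have hτ0 : 0 < τ := by linarith
  set d := setDist D B
  have hsq : Integrable (fun x => ‖G x‖ ^ 2) volume := h.memLp_grad.norm.integrable_sq
  have hfin : volume (closure D) ≠ ⊤ := hD.isCompact_closure.measure_lt_top.ne
  have h1 : ∫ x in D, ‖G x‖ ^ 2 ≤ ∫ x in closure D, ‖G x‖ ^ 2 :=
    setIntegral_mono_set hsq.integrableOn (Eventually.of_forall fun x => sq_nonneg _)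
      (LE.le.eventuallyLE subset_closure)
  have h2 : ∫ x in closure D, ‖G x‖ ^ 2
      ≤ ∫ x in closure D, (M * τ * Real.exp (-(τ * d))) ^ 2 := by
    refine setIntegral_mono_on_ae hsq.integrableOn (integrableOn_const hfin)
      isClosed_closure.measurableSet ?_
    filter_upwards [hM τ hτ v G h] with x hx hxD
    exact pow_le_pow_left₀ (norm_nonneg _) (hx hxD) 2
  rw [setIntegral_const, smul_eq_mul] at h2
  have hee : Real.exp (-2 * τ * d) = Real.exp (-(τ * d)) ^ 2 := by
    rw [← Real.exp_nat_mul]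
    congr 1
    push_cast
    ring
  rw [hee]
  refine (h1.trans h2).trans ?_
  have h3 : 0 ≤ τ ^ 2 * Real.exp (-(τ * d)) ^ 2 := by positivity
  have h4 : W * (M * τ * Real.exp (-(τ * d))) ^ 2
      = M ^ 2 * W * τ ^ 2 * Real.exp (-(τ * d)) ^ 2 := by ring
  rw [h4]
  nlinarith

theorem hasInnerBalls_of_mem_closure {S : Set E3} {x : E3} (hx : x ∈ closure S)
    (h : x ∈ frontier S → HasInnerBalls S x) : HasInnerBalls S x := by
  by_cases hi : x ∈ interior S
  · exact hasInnerBalls_of_mem_interior hi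
  · exact h ⟨hx, hi⟩

theorem mainTheorem3 (D B : Set E3) (f : E3 → ℝ)
    (hD : Bornology.IsBounded D) (hDne : D.Nonempty)
    (hB : IsOpen B) (hBne : B.Nonempty)
    (hDB : Disjoint (closure B) (closure D))
    (hf : EmissionCondition B f)
    (hab : (HasC1Boundary D ∧ ConeCondition B) ∨
      (ConeCondition D ∧ ConeCondition B ∧ Convex ℝ B)) :
    ∃ C : ℝ, 0 < C ∧ ∀ τ : ℝ, 1 ≤ τ →
      (∃ (v : E3 → ℝ) (G : E3 → E3), IsWeakSolution τ f v G) ∧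
      ∀ (v : E3 → ℝ) (G : E3 → E3), IsWeakSolution τ f v G →
        C⁻¹ * τ ^ (-7 : ℤ) * Real.exp (-2 * τ * setDist D B) ≤ ∫ x in D, ‖G x‖ ^ 2 ∧
        ∫ x in D, ‖G x‖ ^ 2 ≤ C * τ ^ 2 * Real.exp (-2 * τ * setDist D B) := by
  have hBcone : ConeCondition B := by
    rcases hab with h | h
    · exact h.2
    · exact h.2.1
  obtain ⟨p, hp, q, hq, hpq⟩ := exists_setDist_eq hD hDne hBne
  have hd : 0 < setDist D B := by
    rw [← hpq, norm_pos_iff, sub_ne_zero]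
    rintro rfl
    exact Set.disjoint_left.1 hDB hq hp
  have hpb : HasInnerBalls D p := hasInnerBalls_of_mem_closure hp fun hpf => by
    rcases hab with h | h
    · exact h.1.hasInnerBalls hpf
    · exact h.1.hasInnerBalls hpf
  have hqb : HasInnerBalls B q := hasInnerBalls_of_mem_closure hq fun hqf =>
    hBcone.hasInnerBalls hqf
  obtain ⟨c, hc, hlow⟩ := exists_lower_bound hf hB (volume_frontier_eq_zero hB hBcone) hDB hpq
    hpb hqb
  obtain ⟨M, hM, hup⟩ := exists_upper_bound hf hD hd
  refine ⟨max M c⁻¹, lt_max_of_lt_left hM, fun τ hτ => ?_⟩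
  have hτ0 : 0 < τ := by linarith
  refine ⟨exists_isWeakSolution hτ0 hf.1, fun v G h => ⟨?_, ?_⟩⟩
  · refine le_trans ?_ (hlow τ hτ v G h)
    gcongr
    exact inv_le_of_inv_le₀ hc (le_max_right _ _)
  · refine (hup τ hτ v G h).trans ?_
    gcongr
    exact le_max_left _ _
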